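/- **Setting.** Let $\mathbb D$ be an irreducible bounded symmetric domain of tube type in a complex vector space $V_{\mathbb C}$ of dimension $d$, realized as the unit ball of the associated simple positive Hermitian Jordan triple system with triple product $\{x\bar yz\}=(Q(x+z)-Q(x)-Q(z))\bar y$, write $D(x,y)z=\{x\bar y z\}$, and let $V$ be a real form of $V_{\mathbb C}$ whose conjugation $\tau$ preserves $\mathbb D$ (equivalently, the triple product). $V_{\mathbb C}$ carries the automorphism-invariant Hermitian inner product $(\cdot,\cdot)$ for which minimal tripotents of $V_{\mathbb C}$ have norm $1$, $V$ its restriction, and both carry the corresponding Lebesgue measures. Let $L$ be the identity component of the group of linear automorphisms of the triple system commuting with $\tau$, and $dl$ its normalized Haar measure. Let $\mathfrak h=\mathfrak q+\mathfrak l$ be the Lie algebra of vector fields on $V$ with $\mathfrak q=\{\xi_v=v-Q(x)v:\ v\in V\}$ and $\mathfrak l$ the derivations of $V$. Let $e_1,\dots,e_r$ be a frame of $V$ (a maximal family of pairwise orthogonal minimal tripotents of $V$), $\mathfrak a=\mathbb Re_1+\dots+\mathbb Re_r\subset V$, identified with the span of the $\xi_{e_j}$ in $\mathfrak q$, and $\beta_j\in\mathfrak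 a^*$ with $\beta_j(e_k)=2\delta_{jk}$. Assume that the root system of $(\mathfrak h,\mathfrak a)$ is either $\{\pm\beta_j\}\cup\{\frac{\pm\beta_j\pm\beta_k}2: j\ne k\}$ (type $C_r$, $r\ge1$) or $\{\frac{\pm\beta_j\pm\beta_k}2:j\neq k\}$ with $r\ge3$ (type $D_r$), and let $a$ be the multiplicity of the roots $\frac{\beta_j-\beta_k}2$. **Spherical polynomials.** For integers $m_1\ge\dots\ge m_r\ge0$ let $\Omega_{\mathbf m}$ be the symmetric Jack polynomial in $r$ variables with $\prod_{j}(U_j+\alpha)\,\Omega_{\mathbf m}=\prod_{k}\big(\tfrac a2(r-k)+1+\alpha+m_k\big)\Omega_{\mathbf m}$ for all integers $\alpha\ge0$ and $\Omega_{\mathbf m}(1,\dots,1)=1$, where $U_j f=D_j(y_jf)-\frac a2\sum_{i<j}s_{ij}f$, $D_j=\partial_j+\frac a2\sum_{i\ne j}\frac{1-s_{ij}}{y_j-y_i}$, and $s_{ij}$ interchanges $y_i$ and $y_j$. Let $p_{\mathbf n}$ be the $L$-invariant holomorphic polynomial on $V_{\mathbb C}$, homogeneous of degree $|\mathbf n|=\sum_j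 n_j$, with $$p_{\mathbf n}(x_1e_1+\dots+x_re_r)=\Omega_{\mathbf m}(x_1^2,\dots,x_r^2),\qquad \mathbf n=(m_1,m_1,\dots,m_r,m_r)$$ for type $C_r$, and, with an additional integer $m\ge0$, $$p_{\mathbf n}(x_1e_1+\dots+x_re_r)=(x_1\cdots x_r)^m\,\Omega_{\mathbf m}(x_1^2,\dots,x_r^2),\qquad \mathbf n=(2m_1+m,\dots,2m_r+m)$$ for type $D_r$. **Transforms.** For $\nu>0$ let $\mathcal F_\nu$ be the Fock space of entire functions on $V_{\mathbb C}$ with $\|f\|^2_{\mathcal F_\nu}=\frac{\nu^d}{\pi^d}\int_{V_{\mathbb C}}|f(z)|^2e^{-\nu\|z\|^2}dm(z)<\infty$, and $\mathcal F=\mathcal F_1$. Let $R:\mathcal F_\nu\to L^2(V)$ be the bounded operator $Rf(x)=f(x)e^{-\frac\nu2\|x\|^2}$ and let the Segal–Bargmann transform $U$ be the isometric part in the polar decomposition $R=|R|\,U$, $|R|=(RR^*)^{1/2}$. Extend $\lambda\in\mathfrak a^*$ to $V$ by the orthogonal projection onto $\mathfrak a$, let $\|\lambda\|$ be the dual norm,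 and put $J_\lambda(x)=\int_Le^{-i\lambda(lx)}\,dl$ and $\widetilde f(\lambda)=\int_Vf(x)e^{i\lambda(x)}dx$. The Hermite polynomial $\zeta_{\mathbf n,\nu}$ is defined by the Rodrigues type formula $$\zeta_{\mathbf n,\nu}(\lambda)=\frac1{\|p_{\mathbf n}\|^2_{\mathcal F}}\;p_{\mathbf n}(\partial_x)\Big(e^{\frac\nu2\|x\|^2}J_\lambda(x)\Big)\Big|_{x=0},$$ where $p_{\mathbf n}(\partial_x)$ is obtained by replacing orthonormal coordinates of $V$ by the corresponding partial derivatives. **Proposition 8.3.** For every $\lambda\in\mathfrak a^*$ the function $Up_{\mathbf n}$ is integrable on $V$ and $$\widetilde{Up_{\mathbf n}}(\lambda)=(-\nu)^{-|\mathbf n|}\Big(\frac{2\pi}\nu\Big)^{\frac d4}\,\|p_{\mathbf n}\|^2_{\mathcal F}\;\zeta_{\mathbf n,\nu}(\lambda)\,e^{-\frac1{4\nu}\|\lambda\|^2}.$$ -/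

import Mathlib

open MeasureTheory
open scoped ENNReal

noncomputable section
namespace SegalBargmann

/-- The real form `V = ℝ^d`. -/
abbrev RSp (d : ℕ) := EuclideanSpace ℝ (Fin d)
/-- The complex space `V_ℂ = ℂ^d`. -/
abbrev CSp (d : ℕ) := EuclideanSpace ℂ (Fin d)

/-- The inclusion of the real form. -/
def incl {d : ℕ} : RSp d →ₗ[ℝ] CSp d where
  toFun x := WithLp.toLp 2 fun j => (x j : ℂ)
  map_add' x y := by ext j; simp
  map_smul' c x := by ext j; simp

section Fock
variable {d : ℕ}

/-- The density `(ν/π)^d e^{-ν|z|²}`. -/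
def gaussWeight (d : ℕ) (ν : ℝ) (z : CSp d) : ℝ := (ν / Real.pi) ^ d * Real.exp (-ν * ‖z‖ ^ 2)

/-- The Gaussian measure `(ν/π)^d e^{-ν|z|²} dm(z)` on `ℂ^d`. -/
def fockMeasure (d : ℕ) (ν : ℝ) : Measure (CSp d) :=
  volume.withDensity fun z => ENNReal.ofReal (gaussWeight d ν z)

/-- The Fock space `𝓕_ν`: the (classes of) entire functions in `L²(fockMeasure)`. -/
def fockSpace (d : ℕ) (ν : ℝ) : Submodule ℂ (Lp ℂ 2 (fockMeasure d ν)) where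
  carrier := {f | ∃ g : CSp d → ℂ, Differentiable ℂ g ∧ f =ᵐ[fockMeasure d ν] g}
  add_mem' := by
    rintro f₁ f₂ ⟨g₁, h₁, e₁⟩ ⟨g₂, h₂, e₂⟩
    exact ⟨g₁ + g₂, h₁.add h₂, (Lp.coeFn_add f₁ f₂).trans (e₁.add e₂)⟩
  zero_mem' := ⟨0, differentiable_const 0, Lp.coeFn_zero _ _ _⟩
  smul_mem' := by
    rintro c f ⟨g, h, e⟩
    exact ⟨c • g, h.const_smul c, (Lp.coeFn_smul c f).trans (e.const_smul c)⟩

/-- The entire function represented by an element of the Fock space. -/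
def fockRep {ν : ℝ} (f : fockSpace d ν) : CSp d → ℂ := Classical.choose f.2

theorem fockRep_differentiable {ν : ℝ} (f : fockSpace d ν) : Differentiable ℂ (fockRep f) :=
  (Classical.choose_spec f.2).1

theorem fockRep_ae {ν : ℝ} (f : fockSpace d ν) :
    (f : Lp ℂ 2 (fockMeasure d ν)) =ᵐ[fockMeasure d ν] fockRep f :=
  (Classical.choose_spec f.2).2

theorem measurable_gaussWeight (ν : ℝ) :
    Measurable fun z : CSp d => ENNReal.ofReal (gaussWeight d ν z) := by
  unfold gaussWeight; fun_prop

theorem gaussWeight_pos {ν : ℝ} (hν : 0 < ν) (z : CSp d) : 0 < gaussWeight d ν z := by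
  unfold gaussWeight; positivity

theorem volume_ac {ν : ℝ} (hν : 0 < ν) :
    (volume : Measure (CSp d)) ≪ fockMeasure d ν := by
  refine withDensity_absolutelyContinuous' (measurable_gaussWeight ν).aemeasurable ?_
  refine Filter.Eventually.of_forall fun z => ?_
  simpa using gaussWeight_pos hν z

theorem eq_of_ae_eq {ν : ℝ} (hν : 0 < ν) {g h : CSp d → ℂ} (hg : Continuous g)
    (hh : Continuous h) (e : g =ᵐ[fockMeasure d ν] h) : g = h :=
  (Continuous.ae_eq_iff_eq volume hg hh).1 ((volume_ac hν).ae_le e)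

theorem fockRep_eq {ν : ℝ} (hν : 0 < ν) {f : fockSpace d ν} {g : CSp d → ℂ}
    (hg : Differentiable ℂ g) (e : (f : Lp ℂ 2 (fockMeasure d ν)) =ᵐ[fockMeasure d ν] g) :
    fockRep f = g :=
  eq_of_ae_eq hν (fockRep_differentiable f).continuous hg.continuous ((fockRep_ae f).symm.trans e)

theorem fockRep_add {ν : ℝ} (hν : 0 < ν) (f g : fockSpace d ν) :
    fockRep (f + g) = fockRep f + fockRep g := by
  refine fockRep_eq hν ((fockRep_differentiable f).add (fockRep_differentiable g)) ?_
  exact (Lp.coeFn_add _ _).trans ((fockRep_ae f).add (fockRep_ae g))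

theorem fockRep_smul {ν : ℝ} (hν : 0 < ν) (c : ℂ) (f : fockSpace d ν) :
    fockRep (c • f) = c • fockRep f := by
  refine fockRep_eq hν ((fockRep_differentiable f).const_smul c) ?_
  exact (Lp.coeFn_smul _ _).trans ((fockRep_ae f).const_smul c)

/-- Multiplication by a unit complex number preserves the volume. -/
theorem measurePreserving_smul {c : ℂ} (hc : ‖c‖ = 1) :
    MeasurePreserving (fun w : CSp d => c • w) volume volume := by
  have hc0 : c ≠ 0 := by rintro rfl; simp at hc
  let e : CSp d ≃ₗᵢ[ℝ] CSp d :=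
    { (LinearEquiv.smulOfNeZero ℂ (CSp d) c hc0).restrictScalars ℝ with
      norm_map' := fun x => by
        change ‖c • x‖ = ‖x‖
        rw [norm_smul, hc, one_mul] }
  exact e.measurePreserving

theorem enorm_sq_le_circle {h : CSp d → ℂ} (hh : Differentiable ℂ h) (w : CSp d) :
    ‖h 0‖ₑ ^ 2 ≤ ENNReal.ofReal (2 * Real.pi)⁻¹ *
      ∫⁻ θ in Set.Ioc 0 (2 * Real.pi), ‖h (circleMap 0 1 θ • w)‖ₑ ^ 2 := by
  let k : ℂ → ℂ := fun ζ => h (ζ • w) ^ 2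
  have hk : Differentiable ℂ k := (hh.comp (by fun_prop)).pow 2
  have h1 : Real.circleAverage k 0 1 = k 0 := hk.diffContOnCl.circleAverage
  have h2 : k 0 = h 0 ^ 2 := by simp [k]
  have h3 : ‖h 0‖ₑ ^ 2 = ‖k 0‖ₑ := by rw [h2, enorm_pow]
  rw [h3, ← h1, Real.circleAverage_def, enorm_smul,
    intervalIntegral.integral_of_le (by positivity)]
  gcongr
  · rw [Real.enorm_eq_ofReal (by positivity)]
  · refine (enorm_integral_le_lintegral_enorm _).trans (le_of_eq ?_)
    simp [k]

theorem mean_value_ball {h : CSp d → ℂ} (hh : Differentiable ℂ h) :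
    ‖h 0‖ₑ ^ 2 * volume (Metric.ball (0 : CSp d) 1) ≤
      ∫⁻ w in Metric.ball (0 : CSp d) 1, ‖h w‖ₑ ^ 2 := by
  have hc := hh.continuous
  have hcm : Continuous fun θ : ℝ => circleMap 0 1 θ := continuous_circleMap 0 1
  calc ‖h 0‖ₑ ^ 2 * volume (Metric.ball (0 : CSp d) 1)
      = ∫⁻ _ in Metric.ball (0 : CSp d) 1, ‖h 0‖ₑ ^ 2 := by rw [setLIntegral_const]
    _ ≤ ∫⁻ w in Metric.ball (0 : CSp d) 1, ENNReal.ofReal (2 * Real.pi)⁻¹ *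
          ∫⁻ θ in Set.Ioc 0 (2 * Real.pi), ‖h (circleMap 0 1 θ • w)‖ₑ ^ 2 :=
        lintegral_mono fun w => enorm_sq_le_circle hh w
    _ = ENNReal.ofReal (2 * Real.pi)⁻¹ * ∫⁻ w in Metric.ball (0 : CSp d) 1,
          ∫⁻ θ in Set.Ioc 0 (2 * Real.pi), ‖h (circleMap 0 1 θ • w)‖ₑ ^ 2 :=
        lintegral_const_mul' _ _ ENNReal.ofReal_ne_top
    _ = ENNReal.ofReal (2 * Real.pi)⁻¹ * ∫⁻ θ in Set.Ioc 0 (2 * Real.pi),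
          ∫⁻ w in Metric.ball (0 : CSp d) 1, ‖h (circleMap 0 1 θ • w)‖ₑ ^ 2 := by
        congr 1
        refine lintegral_lintegral_swap (Continuous.aemeasurable ?_)
        have : Continuous fun q : CSp d × ℝ => h (circleMap 0 1 q.2 • q.1) :=
          hc.comp ((hcm.comp continuous_snd).smul continuous_fst)
        simp only [Function.uncurry_def]
        exact (ENNReal.continuous_pow 2).comp this.enorm
    _ = ENNReal.ofReal (2 * Real.pi)⁻¹ * ∫⁻ _ in Set.Ioc 0 (2 * Real.pi),
          ∫⁻ w in Metric.ball (0 : CSp d) 1, ‖h w‖ₑ ^ 2 := by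
        congr 1
        refine lintegral_congr fun θ => ?_
        have hn : ‖circleMap 0 1 θ‖ = 1 := by simp
        have hpre : (fun w : CSp d => circleMap 0 1 θ • w) ⁻¹' Metric.ball (0 : CSp d) 1
            = Metric.ball (0 : CSp d) 1 := by
          ext w; simp [norm_smul]
        have := (measurePreserving_smul (d := d) hn).setLIntegral_comp_preimage
          (s := Metric.ball (0 : CSp d) 1) Metric.isOpen_ball.measurableSet
          (f := fun w => ‖h w‖ₑ ^ 2) (by fun_prop)
        rw [hpre] at this
        exact this
    _ = ∫⁻ w in Metric.ball (0 : CSp d) 1, ‖h w‖ₑ ^ 2 := by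
        rw [setLIntegral_const, Real.volume_Ioc, sub_zero, mul_comm (∫⁻ _ in _, _), ← mul_assoc,
          ← ENNReal.ofReal_mul (by positivity), inv_mul_cancel₀ (by positivity),
          ENNReal.ofReal_one, one_mul]

/-- The local estimate. -/
theorem local_estimate {ν : ℝ} (hν : 0 < ν) {g : CSp d → ℂ} (hg : Differentiable ℂ g)
    (z : CSp d) :
    ‖g z‖ₑ ^ 2 * ENNReal.ofReal (Real.exp (-ν * ‖z‖ ^ 2)) *
        volume (Metric.ball (0 : CSp d) 1) ≤
      ENNReal.ofReal (Real.exp ν) * ∫⁻ w in Metric.ball z 1,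
        ‖g w‖ₑ ^ 2 * ENNReal.ofReal (Real.exp (-ν * ‖w‖ ^ 2)) := by
  let h : CSp d → ℂ := fun w => g (z + w) * Complex.exp (-ν * inner ℂ z w)
  have hh : Differentiable ℂ h := by
    have h1 : Differentiable ℂ fun w : CSp d => (inner ℂ z w : ℂ) :=
      (innerSL ℂ z).differentiable
    exact (hg.comp (by fun_prop)).mul ((h1.const_mul _).cexp)
  have key : ∀ w : CSp d, ‖w‖ ≤ 1 → ‖h w‖ₑ ^ 2 * ENNReal.ofReal (Real.exp (-ν * ‖z‖ ^ 2)) ≤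
      ENNReal.ofReal (Real.exp ν) *
        (‖g (z + w)‖ₑ ^ 2 * ENNReal.ofReal (Real.exp (-ν * ‖z + w‖ ^ 2))) := by
    intro w hw
    have e1 : ‖h w‖ₑ ^ 2 = ‖g (z + w)‖ₑ ^ 2 *
        ENNReal.ofReal (Real.exp (-ν * (2 * RCLike.re (inner ℂ z w : ℂ)))) := by
      simp only [h]
      rw [enorm_mul, mul_pow]
      congr 1
      rw [← ofReal_norm, ← ENNReal.ofReal_pow (norm_nonneg _), Complex.norm_exp,
        ← Real.exp_nat_mul]
      congr 2
      simp [Complex.mul_re]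
      ring
    rw [e1, mul_assoc, ← ENNReal.ofReal_mul (Real.exp_nonneg _), ← Real.exp_add,
      mul_left_comm (ENNReal.ofReal (Real.exp ν)), ← ENNReal.ofReal_mul (Real.exp_nonneg _), ← Real.exp_add]
    refine mul_le_mul_right (ENNReal.ofReal_le_ofReal (Real.exp_le_exp.2 ?_)) _
    rw [norm_add_sq (𝕜 := ℂ)]
    have : ‖w‖ ^ 2 ≤ 1 := by
      have := norm_nonneg w
      nlinarith
    nlinarith
  have h0 : ‖h 0‖ₑ = ‖g z‖ₑ := by simp [h]
  have mv := mean_value_ball hh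
  rw [h0] at mv
  calc _ = ENNReal.ofReal (Real.exp (-ν * ‖z‖ ^ 2)) *
          (‖g z‖ₑ ^ 2 * volume (Metric.ball (0 : CSp d) 1)) := by ring
    _ ≤ ENNReal.ofReal (Real.exp (-ν * ‖z‖ ^ 2)) *
          ∫⁻ w in Metric.ball (0 : CSp d) 1, ‖h w‖ₑ ^ 2 := by gcongr
    _ = ∫⁻ w in Metric.ball (0 : CSp d) 1,
          ENNReal.ofReal (Real.exp (-ν * ‖z‖ ^ 2)) * ‖h w‖ₑ ^ 2 :=
        (lintegral_const_mul' _ _ ENNReal.ofReal_ne_top).symm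
    _ ≤ ∫⁻ w in Metric.ball (0 : CSp d) 1, ENNReal.ofReal (Real.exp ν) *
        (‖g (z + w)‖ₑ ^ 2 * ENNReal.ofReal (Real.exp (-ν * ‖z + w‖ ^ 2))) := by
        refine setLIntegral_mono' Metric.isOpen_ball.measurableSet fun w hw => ?_
        rw [mul_comm]
        exact key w (by simpa using (Metric.mem_ball.1 hw).le)
    _ = ENNReal.ofReal (Real.exp ν) * ∫⁻ w in Metric.ball (0 : CSp d) 1,
        (‖g (z + w)‖ₑ ^ 2 * ENNReal.ofReal (Real.exp (-ν * ‖z + w‖ ^ 2))) :=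
        lintegral_const_mul' _ _ ENNReal.ofReal_ne_top
    _ = _ := by
        congr 1
        have hpre : (fun w : CSp d => z + w) ⁻¹' Metric.ball z 1 = Metric.ball (0 : CSp d) 1 := by
          ext w; simp
        have := (measurePreserving_add_left (volume : Measure (CSp d)) z).setLIntegral_comp_preimage
          (s := Metric.ball z 1) Metric.isOpen_ball.measurableSet
          (f := fun w => ‖g w‖ₑ ^ 2 * ENNReal.ofReal (Real.exp (-ν * ‖w‖ ^ 2)))
          (by have := hg.continuous; fun_prop)
        rw [hpre] at this
        exact this

theorem lintegral_fock {ν : ℝ} (hν : 0 < ν) (f : fockSpace d ν) :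
    ENNReal.ofReal ((ν / Real.pi) ^ d) *
      ∫⁻ z, ‖fockRep f z‖ₑ ^ 2 * ENNReal.ofReal (Real.exp (-ν * ‖z‖ ^ 2)) = ‖f‖ₑ ^ 2 := by
  have hc := (fockRep_differentiable f).continuous
  have h1 : ‖f‖ₑ = eLpNorm (fockRep f) 2 (fockMeasure d ν) := by
    change ‖(f : Lp ℂ 2 (fockMeasure d ν))‖ₑ = _
    rw [Lp.enorm_def]
    exact eLpNorm_congr_ae (fockRep_ae f)
  have h2 : eLpNorm (fockRep f) 2 (fockMeasure d ν) ^ 2 =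
      ∫⁻ z, ‖fockRep f z‖ₑ ^ 2 ∂(fockMeasure d ν) := by
    have := eLpNorm_nnreal_pow_eq_lintegral (f := fockRep f) (μ := fockMeasure d ν)
      (p := 2) two_ne_zero
    simpa using this
  rw [h1, h2, fockMeasure, lintegral_withDensity_eq_lintegral_mul _ (measurable_gaussWeight ν)
    (by fun_prop), ← lintegral_const_mul' _ _ ENNReal.ofReal_ne_top]
  refine lintegral_congr fun z => ?_
  simp only [Pi.mul_apply, gaussWeight]
  rw [ENNReal.ofReal_mul (by positivity)]
  ring


theorem norm_incl (x : RSp d) : ‖incl x‖ = ‖x‖ := by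
  rw [EuclideanSpace.norm_eq, EuclideanSpace.norm_eq]
  simp [incl]

theorem continuous_incl : Continuous (incl : RSp d → CSp d) :=
  LinearMap.continuous_of_finiteDimensional _

theorem dist_re_le (z : CSp d) (x : RSp d) :
    dist x (WithLp.toLp 2 fun j => (z j).re) ≤ dist z (incl x) := by
  rw [EuclideanSpace.dist_eq, EuclideanSpace.dist_eq]
  refine Real.sqrt_le_sqrt (Finset.sum_le_sum fun j _ => ?_)
  have h : |(z j - (x j : ℂ)).re| ≤ ‖z j - (x j : ℂ)‖ := Complex.abs_re_le_norm _
  have h2 : dist (x j) ((z j).re) ≤ dist (z j) ((x j : ℂ)) := by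
    rw [Complex.dist_eq, Real.dist_eq, abs_sub_comm]
    simpa using h
  simpa [incl] using pow_le_pow_left₀ dist_nonneg h2 2

/-- The restriction map on functions: `R f (x) = f(x) e^{-ν|x|²/2}`. -/
def restrictFun (ν : ℝ) (g : CSp d → ℂ) (x : RSp d) : ℂ :=
  g (incl x) * (Real.exp (-ν / 2 * ‖x‖ ^ 2) : ℝ)

theorem continuous_restrictFun (ν : ℝ) {g : CSp d → ℂ} (hg : Continuous g) :
    Continuous (restrictFun ν g) := by
  unfold restrictFun
  exact (hg.comp continuous_incl).mul (by fun_prop)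

theorem volume_ball_ne_zero : volume (Metric.ball (0 : CSp d) 1) ≠ 0 :=
  (Metric.measure_ball_pos volume _ one_pos).ne'

theorem volume_ball_ne_top : volume (Metric.ball (0 : CSp d) 1) ≠ ∞ :=
  Metric.isBounded_ball.measure_lt_top.ne

theorem restrictFun_estimate {ν : ℝ} (hν : 0 < ν) : ∃ K : ℝ≥0∞, K ≠ ∞ ∧
    ∀ f : fockSpace d ν, ∫⁻ x, ‖restrictFun ν (fockRep f) x‖ₑ ^ 2 ≤ K * ‖f‖ₑ ^ 2 := by
  set b := volume (Metric.ball (0 : CSp d) 1) with hb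
  set b' := volume (Metric.ball (0 : RSp d) 1) with hb'
  set c := ENNReal.ofReal ((ν / Real.pi) ^ d) with hc
  have hc0 : c ≠ 0 := by
    have : 0 < (ν / Real.pi) ^ d := by positivity
    simpa [hc] using this
  refine ⟨ENNReal.ofReal (Real.exp ν) * b' / b / c, ?_, fun f => ?_⟩
  · have : b' ≠ ∞ := Metric.isBounded_ball.measure_lt_top.ne
    exact ENNReal.div_ne_top (ENNReal.div_ne_top (ENNReal.mul_ne_top ENNReal.ofReal_ne_top this)
      volume_ball_ne_zero) hc0
  set g := fockRep f
  have hg : Differentiable ℂ g := fockRep_differentiable f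
  have hgc := hg.continuous
  let G : CSp d → ℝ≥0∞ := fun z => ‖g z‖ₑ ^ 2 * ENNReal.ofReal (Real.exp (-ν * ‖z‖ ^ 2))
  have hG : Measurable G := by fun_prop
  have e1 : ∀ x : RSp d, ‖restrictFun ν g x‖ₑ ^ 2 * b ≤
      ENNReal.ofReal (Real.exp ν) * ∫⁻ w in Metric.ball (incl x) 1, G w := by
    intro x
    refine le_trans (le_of_eq ?_) (local_estimate hν hg (incl x))
    rw [restrictFun, enorm_mul, mul_pow]
    congr 2
    rw [← ofReal_norm, ← ENNReal.ofReal_pow (norm_nonneg _), Complex.norm_real,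
      Real.norm_of_nonneg (Real.exp_nonneg _), ← Real.exp_nat_mul, norm_incl]
    congr 2
    push_cast; ring
  have hS : MeasurableSet {q : RSp d × CSp d | q.2 ∈ Metric.ball (incl q.1) 1} := by
    have : IsOpen {q : RSp d × CSp d | q.2 ∈ Metric.ball (incl q.1) 1} :=
      isOpen_lt (continuous_snd.dist (continuous_incl.comp continuous_fst)) continuous_const
    exact this.measurableSet
  have e2 : ∫⁻ x : RSp d, ∫⁻ w in Metric.ball (incl x) 1, G w ≤ b' * ∫⁻ z, G z := by
    calc ∫⁻ x : RSp d, ∫⁻ w in Metric.ball (incl x) 1, G w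
        = ∫⁻ x : RSp d, ∫⁻ w, (Metric.ball (incl x) 1).indicator G w := by
          refine lintegral_congr fun x => ?_
          rw [lintegral_indicator Metric.isOpen_ball.measurableSet]
      _ = ∫⁻ w, ∫⁻ x : RSp d, (Metric.ball (incl x) 1).indicator G w := by
          refine lintegral_lintegral_swap (Measurable.aemeasurable ?_)
          have : Function.uncurry (fun (x : RSp d) w => (Metric.ball (incl x) 1).indicator G w)
              = {q : RSp d × CSp d | q.2 ∈ Metric.ball (incl q.1) 1}.indicator
                (fun q => G q.2) := by
            ext ⟨x, w⟩; simp [Function.uncurry, Set.indicator]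
          rw [this]
          exact (hG.comp measurable_snd).indicator hS
      _ ≤ ∫⁻ w, b' * G w := by
          refine lintegral_mono fun w => ?_
          have hle : ∀ x : RSp d, (Metric.ball (incl x) 1).indicator G w ≤
              (Metric.ball (WithLp.toLp 2 fun j => (w j).re : RSp d) 1).indicator
                (fun _ => G w) x := by
            intro x
            by_cases hx : w ∈ Metric.ball (incl x) 1
            · have : x ∈ Metric.ball (WithLp.toLp 2 fun j => (w j).re : RSp d) 1 :=
                lt_of_le_of_lt (dist_re_le w x) hx
              rw [Set.indicator_of_mem hx, Set.indicator_of_mem this]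
            · rw [Set.indicator_of_notMem hx]; exact zero_le
          refine (lintegral_mono hle).trans (le_of_eq ?_)
          rw [lintegral_indicator Metric.isOpen_ball.measurableSet, setLIntegral_const, mul_comm,
            hb', Measure.addHaar_ball_center]
      _ = b' * ∫⁻ z, G z := lintegral_const_mul _ hG
  have e3 : (∫⁻ x, ‖restrictFun ν g x‖ₑ ^ 2) * b ≤
      ENNReal.ofReal (Real.exp ν) * (b' * ∫⁻ z, G z) := by
    rw [← lintegral_mul_const' _ _ volume_ball_ne_top]
    refine (lintegral_mono e1).trans ?_
    rw [lintegral_const_mul' _ _ ENNReal.ofReal_ne_top]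
    gcongr
  have e4 : c * ∫⁻ z, G z = ‖f‖ₑ ^ 2 := lintegral_fock hν f
  have e5 : ∫⁻ z, G z = ‖f‖ₑ ^ 2 / c :=
    (ENNReal.eq_div_iff hc0 ENNReal.ofReal_ne_top).2 e4
  rw [e5] at e3
  refine (ENNReal.le_div_iff_mul_le (Or.inl volume_ball_ne_zero)
    (Or.inl volume_ball_ne_top)).2 e3 |>.trans (le_of_eq ?_)
  simp only [div_eq_mul_inv]
  ring

theorem memLp_restrictFun {ν : ℝ} (hν : 0 < ν) (f : fockSpace d ν) :
    MemLp (restrictFun ν (fockRep f)) 2 (volume : Measure (RSp d)) := by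
  obtain ⟨K, hK, h⟩ := restrictFun_estimate (d := d) hν
  refine ⟨(continuous_restrictFun ν
    (fockRep_differentiable f).continuous).aestronglyMeasurable, ?_⟩
  have h2 := eLpNorm_nnreal_pow_eq_lintegral (f := restrictFun ν (fockRep f))
      (μ := (volume : Measure (RSp d))) (p := 2) two_ne_zero
  have h3 : eLpNorm (restrictFun ν (fockRep f)) 2 (volume : Measure (RSp d)) ^ 2 < ∞ := by
    have h4 := (h f).trans_lt (ENNReal.mul_lt_top hK.lt_top (by simp))
    refine lt_of_eq_of_lt ?_ h4
    simpa using h2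
  by_contra hcon
  rw [not_lt, top_le_iff] at hcon
  rw [hcon] at h3
  simp at h3

/-- The restriction operator `R : 𝓕_ν → L²(V)`, as a linear map. -/
def restrictLin {ν : ℝ} (hν : 0 < ν) : fockSpace d ν →ₗ[ℂ] Lp ℂ 2 (volume : Measure (RSp d)) where
  toFun f := (memLp_restrictFun hν f).toLp _
  map_add' f g := by
    rw [← MemLp.toLp_add]
    refine MemLp.toLp_congr _ _ (Filter.Eventually.of_forall fun x => ?_)
    simp [restrictFun, fockRep_add hν, add_mul]
  map_smul' c f := by
    rw [RingHom.id_apply, ← MemLp.toLp_const_smul]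
    refine MemLp.toLp_congr _ _ (Filter.Eventually.of_forall fun x => ?_)
    simp [restrictFun, fockRep_smul hν, mul_assoc]

theorem restrictLin_bound {ν : ℝ} (hν : 0 < ν) :
    ∃ C : ℝ, ∀ f : fockSpace d ν, ‖restrictLin hν f‖ ≤ C * ‖f‖ := by
  obtain ⟨K, hK, h⟩ := restrictFun_estimate (d := d) hν
  refine ⟨Real.sqrt K.toReal, fun f => ?_⟩
  have h2 := eLpNorm_nnreal_pow_eq_lintegral (f := restrictFun ν (fockRep f))
      (μ := (volume : Measure (RSp d))) (p := 2) two_ne_zero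
  have h3 : ‖restrictLin hν f‖ₑ ^ 2 ≤ K * ‖f‖ₑ ^ 2 := by
    have : ‖restrictLin hν f‖ₑ = eLpNorm (restrictFun ν (fockRep f)) 2 volume :=
      by rw [show restrictLin hν f = (memLp_restrictFun hν f).toLp _ from rfl, Lp.enorm_toLp]
    rw [this]
    refine (le_of_eq ?_).trans (h f)
    simpa using h2
  have h4 := ENNReal.toReal_mono (ENNReal.mul_ne_top hK (by simp)) h3
  rw [ENNReal.toReal_mul, ENNReal.toReal_pow, ENNReal.toReal_pow, toReal_enorm, toReal_enorm] at h4
  refine (pow_le_pow_iff_left₀ (norm_nonneg _) (by positivity) two_ne_zero).1 ?_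
  rw [mul_pow, Real.sq_sqrt ENNReal.toReal_nonneg]
  exact h4

/-- The bounded restriction operator `R : 𝓕_ν → L²(V)`. -/
def restrictOp {ν : ℝ} (hν : 0 < ν) :
    fockSpace d ν →L[ℂ] Lp ℂ 2 (volume : Measure (RSp d)) :=
  (restrictLin hν).mkContinuousOfExistsBound (restrictLin_bound hν)

theorem fockRep_bound {ν : ℝ} (hν : 0 < ν) : ∃ K : ℝ, 0 ≤ K ∧ ∀ (f : fockSpace d ν) (z : CSp d),
    ‖fockRep f z‖ ≤ K * Real.exp (ν / 2 * ‖z‖ ^ 2) * ‖f‖ := by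
  set b := volume (Metric.ball (0 : CSp d) 1) with hb
  set c := ENNReal.ofReal ((ν / Real.pi) ^ d) with hc
  have hc0 : c ≠ 0 := by
    have : 0 < (ν / Real.pi) ^ d := by positivity
    simpa [hc] using this
  set K := ENNReal.ofReal (Real.exp ν) / c / b with hK
  have hKt : K ≠ ∞ := ENNReal.div_ne_top (ENNReal.div_ne_top ENNReal.ofReal_ne_top hc0)
    volume_ball_ne_zero
  refine ⟨Real.sqrt K.toReal, Real.sqrt_nonneg _, fun f z => ?_⟩
  have h1 := local_estimate hν (fockRep_differentiable f) z
  have h2 : ‖fockRep f z‖ₑ ^ 2 * ENNReal.ofReal (Real.exp (-ν * ‖z‖ ^ 2)) * b ≤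
      ENNReal.ofReal (Real.exp ν) * (‖f‖ₑ ^ 2 / c) := by
    refine h1.trans ?_
    gcongr
    refine (setLIntegral_le_lintegral _ _).trans (le_of_eq ?_)
    exact (ENNReal.eq_div_iff hc0 ENNReal.ofReal_ne_top).2 (lintegral_fock hν f)
  have h3 : ‖fockRep f z‖ₑ ^ 2 * ENNReal.ofReal (Real.exp (-ν * ‖z‖ ^ 2)) ≤ K * ‖f‖ₑ ^ 2 := by
    refine (ENNReal.le_div_iff_mul_le (Or.inl volume_ball_ne_zero)
      (Or.inl volume_ball_ne_top)).2 h2 |>.trans (le_of_eq ?_)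
    simp only [hK, div_eq_mul_inv]
    ring
  have h4 := ENNReal.toReal_mono (ENNReal.mul_ne_top hKt (by simp)) h3
  rw [ENNReal.toReal_mul, ENNReal.toReal_mul, ENNReal.toReal_pow, ENNReal.toReal_pow,
    toReal_enorm, toReal_enorm, ENNReal.toReal_ofReal (Real.exp_nonneg _)] at h4
  refine (pow_le_pow_iff_left₀ (norm_nonneg _) (by positivity) two_ne_zero).1 ?_
  rw [mul_pow, mul_pow, Real.sq_sqrt ENNReal.toReal_nonneg, ← Real.exp_nat_mul]
  have h5 : Real.exp ((2 : ℕ) * (ν / 2 * ‖z‖ ^ 2)) * Real.exp (-ν * ‖z‖ ^ 2) = 1 := by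
    rw [← Real.exp_add, Real.exp_eq_one_iff]; push_cast; ring
  calc ‖fockRep f z‖ ^ 2 = (‖fockRep f z‖ ^ 2 * Real.exp (-ν * ‖z‖ ^ 2)) *
        Real.exp ((2 : ℕ) * (ν / 2 * ‖z‖ ^ 2)) := by
        rw [mul_assoc, mul_comm (Real.exp (-ν * _)), h5, mul_one]
    _ ≤ (K.toReal * ‖f‖ ^ 2) * Real.exp ((2 : ℕ) * (ν / 2 * ‖z‖ ^ 2)) := by gcongr
    _ = _ := by ring

theorem norm_fderiv_fockRep_le {ν : ℝ} (hν : 0 < ν) (r : ℝ) : ∃ K : ℝ, ∀ (f : fockSpace d ν)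
    (z : CSp d), ‖z‖ < r → ‖fderiv ℂ (fockRep f) z‖ ≤ K * ‖f‖ := by
  obtain ⟨K, hK, h⟩ := fockRep_bound (d := d) hν
  refine ⟨K * Real.exp (ν / 2 * (r + 1) ^ 2), fun f z hz => ?_⟩
  refine ContinuousLinearMap.opNorm_le_of_unit_norm (𝕜 := ℂ) (by positivity) fun v hv => ?_
  let k : ℂ → ℂ := fun t => fockRep f (z + t • v)
  have hd := fockRep_differentiable f
  have hk : Differentiable ℂ k := hd.comp (by fun_prop)
  have h1 : deriv k 0 = fderiv ℂ (fockRep f) z v :=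
    ((hd z).hasFDerivAt.hasLineDerivAt v).deriv
  rw [← h1]
  refine (Complex.norm_deriv_le_of_forall_mem_sphere_norm_le (R := 1)
    (C := K * Real.exp (ν / 2 * (r + 1) ^ 2) * ‖f‖) one_pos hk.diffContOnCl ?_).trans
    (le_of_eq (div_one _))
  intro t ht
  refine (h f _).trans ?_
  have ht1 : ‖t‖ = 1 := by simpa using ht
  have : ‖z + t • v‖ ≤ r + 1 := by
    refine (norm_add_le _ _).trans ?_
    rw [norm_smul, ht1, hv]; linarith
  gcongr

theorem isClosed_fockSpace {ν : ℝ} (hν : 0 < ν) :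
    IsClosed (fockSpace d ν : Set (Lp ℂ 2 (fockMeasure d ν))) := by
  refine IsSeqClosed.isClosed fun u f hu huf => ?_
  let F : ℕ → fockSpace d ν := fun n => ⟨u n, hu n⟩
  have hsub : ∀ n m, fockRep (F n - F m) = fockRep (F n) - fockRep (F m) := by
    intro n m
    have := fockRep_add hν (F n) ((-1 : ℂ) • F m)
    rw [fockRep_smul hν] at this
    simpa [sub_eq_add_neg] using this
  have hcs : CauchySeq F := by
    have := huf.cauchySeq
    rw [Metric.cauchySeq_iff] at this ⊢
    exact this
  have hcm : ∀ ε > 0, ∃ N, ∀ n ≥ N, ∀ m ≥ N, ‖F n - F m‖ < ε := by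
    intro ε hε
    obtain ⟨N, hN⟩ := Metric.cauchySeq_iff.1 hcs ε hε
    exact ⟨N, fun n hn m hm => by simpa [dist_eq_norm] using hN n hn m hm⟩
  obtain ⟨K, hK, hKb⟩ := fockRep_bound (d := d) hν
  have hev : ∀ z, CauchySeq fun n => fockRep (F n) z := by
    intro z
    rw [Metric.cauchySeq_iff]
    intro ε hε
    set M := K * Real.exp (ν / 2 * ‖z‖ ^ 2) + 1
    have hM : 0 < M := by positivity
    obtain ⟨N, hN⟩ := hcm (ε / M) (by positivity)
    refine ⟨N, fun n hn m hm => ?_⟩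
    rw [dist_eq_norm]
    have h1 := hKb (F n - F m) z
    rw [hsub, Pi.sub_apply] at h1
    have h2 := hN n hn m hm
    rw [lt_div_iff₀ hM] at h2
    have h3 : K * Real.exp (ν / 2 * ‖z‖ ^ 2) * ‖F n - F m‖ ≤ ‖F n - F m‖ * M := by
      rw [mul_comm]; gcongr; simp [M]
    linarith
  choose g hg using fun z => cauchySeq_tendsto_of_complete (hev z)
  have hfd : ∀ r : ℝ, ∀ ε > 0, ∃ N, ∀ n ≥ N, ∀ m ≥ N, ∀ z : CSp d, ‖z‖ < r →
      dist (fderiv ℂ (fockRep (F n)) z) (fderiv ℂ (fockRep (F m)) z) < ε := by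
    intro r ε hε
    obtain ⟨K', hK'⟩ := norm_fderiv_fockRep_le (d := d) hν r
    obtain ⟨N, hN⟩ := hcm (ε / (|K'| + 1)) (by positivity)
    refine ⟨N, fun n hn m hm z hz => ?_⟩
    have h1 := hK' (F n - F m) z hz
    rw [hsub, fderiv_sub (fockRep_differentiable _ z) (fockRep_differentiable _ z)] at h1
    rw [dist_eq_norm]
    have h2 := hN n hn m hm
    rw [lt_div_iff₀ (by positivity)] at h2
    have h3 : K' * ‖F n - F m‖ ≤ ‖F n - F m‖ * (|K'| + 1) := by
      rw [mul_comm]; gcongr; linarith [le_abs_self K']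
    linarith
  have hev' : ∀ z, CauchySeq fun n => fderiv ℂ (fockRep (F n)) z := by
    intro z
    rw [Metric.cauchySeq_iff]
    intro ε hε
    obtain ⟨N, hN⟩ := hfd (‖z‖ + 1) ε hε
    exact ⟨N, fun n hn m hm => hN n hn m hm z (by linarith)⟩
  choose g' hg' using fun z => cauchySeq_tendsto_of_complete (hev' z)
  have hgd : Differentiable ℂ g := by
    intro z
    refine (hasFDerivAt_of_tendstoUniformlyOn (s := Metric.ball (0 : CSp d) (‖z‖ + 1))
      (f := fun n => fockRep (F n)) (f' := fun n z => fderiv ℂ (fockRep (F n)) z) (g' := g')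
      (l := Filter.atTop) Metric.isOpen_ball ?_ (fun n w _ =>
        (fockRep_differentiable (F n) w).hasFDerivAt) (fun w _ => hg w)
      (by simp : z ∈ Metric.ball (0 : CSp d) (‖z‖ + 1))).differentiableAt
    refine UniformCauchySeqOn.tendstoUniformlyOn_of_tendsto ?_ (fun w _ => hg' w)
    rw [Metric.uniformCauchySeqOn_iff]
    intro ε hε
    obtain ⟨N, hN⟩ := hfd (‖z‖ + 1) ε hε
    exact ⟨N, fun n hn m hm w hw => hN n hn m hm w (by simpa using hw)⟩
  refine ⟨g, hgd, ?_⟩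
  obtain ⟨ns, hns, hae⟩ := (tendstoInMeasure_of_tendsto_Lp huf).exists_seq_tendsto_ae
  have hall : ∀ᵐ z ∂(fockMeasure d ν), ∀ n, (u n) z = fockRep (F n) z :=
    ae_all_iff.2 fun n => fockRep_ae (F n)
  filter_upwards [hae, hall] with z h1 h2
  refine tendsto_nhds_unique h1 ?_
  simp only [h2]
  exact (hg z).comp hns.tendsto_atTop

/-- Polynomials grow slower than every Gaussian. -/
theorem poly_bound (p : MvPolynomial (Fin d) ℂ) : ∀ ε > 0, ∃ C : ℝ, 0 ≤ C ∧ ∀ z : CSp d,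
    ‖MvPolynomial.eval z.ofLp p‖ ≤ C * Real.exp (ε * ‖z‖ ^ 2) := by
  induction p using MvPolynomial.induction_on with
  | C c =>
    refine fun ε hε => ⟨‖c‖, norm_nonneg _, fun z => ?_⟩
    rw [MvPolynomial.eval_C]
    exact le_mul_of_one_le_right (norm_nonneg _) (Real.one_le_exp (by positivity))
  | add p q hp hq =>
    intro ε hε
    obtain ⟨A, hA, h1⟩ := hp ε hε
    obtain ⟨B, hB, h2⟩ := hq ε hε
    refine ⟨A + B, by positivity, fun z => ?_⟩
    rw [map_add, add_mul]
    exact (norm_add_le _ _).trans (add_le_add (h1 z) (h2 z))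
  | mul_X p i hp =>
    intro ε hε
    obtain ⟨A, hA, h1⟩ := hp (ε / 2) (by positivity)
    refine ⟨A * (1 + 2 / ε), by positivity, fun z => ?_⟩
    rw [map_mul, MvPolynomial.eval_X, norm_mul]
    have h3 : ‖z i‖ ≤ ‖z‖ := PiLp.norm_apply_le z i
    have h4 : ‖z‖ ≤ (1 + 2 / ε) * Real.exp (ε / 2 * ‖z‖ ^ 2) := by
      have h5 : ε / 2 * ‖z‖ ^ 2 + 1 ≤ Real.exp (ε / 2 * ‖z‖ ^ 2) := Real.add_one_le_exp _
      have h6 : (1 + 2 / ε) * (ε / 2 * ‖z‖ ^ 2 + 1) ≤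
          (1 + 2 / ε) * Real.exp (ε / 2 * ‖z‖ ^ 2) := by gcongr
      have h7 : (1 + 2 / ε) * (ε / 2 * ‖z‖ ^ 2 + 1) =
          ε / 2 * ‖z‖ ^ 2 + 1 + ‖z‖ ^ 2 + 2 / ε := by
        field_simp; ring
      have h8 : 0 < 2 / ε := by positivity
      have h9 : 0 ≤ ε / 2 * ‖z‖ ^ 2 := by positivity
      nlinarith [sq_nonneg (‖z‖ - 1)]
    calc _ ≤ (A * Real.exp (ε / 2 * ‖z‖ ^ 2)) *
          ((1 + 2 / ε) * Real.exp (ε / 2 * ‖z‖ ^ 2)) :=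
          mul_le_mul (h1 z) (h3.trans h4) (norm_nonneg _) (by positivity)
      _ = A * (1 + 2 / ε) * (Real.exp (ε / 2 * ‖z‖ ^ 2) * Real.exp (ε / 2 * ‖z‖ ^ 2)) := by ring
      _ = _ := by rw [← Real.exp_add]; congr 2; ring

theorem differentiable_eval (p : MvPolynomial (Fin d) ℂ) :
    Differentiable ℂ fun z : CSp d => MvPolynomial.eval z.ofLp p := by
  induction p using MvPolynomial.induction_on with
  | C c => simp
  | add p q hp hq => simp only [map_add]; exact hp.add hq
  | mul_X p i hp =>
    simp only [map_mul, MvPolynomial.eval_X]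
    exact hp.mul (by fun_prop)

theorem memLp_eval {ν : ℝ} (hν : 0 < ν) (p : MvPolynomial (Fin d) ℂ) :
    MemLp (fun z : CSp d => MvPolynomial.eval z.ofLp p) 2 (fockMeasure d ν) := by
  have hc := (differentiable_eval p).continuous
  rw [memLp_two_iff_integrable_sq_norm hc.aestronglyMeasurable, fockMeasure,
    integrable_withDensity_iff_integrable_smul' (measurable_gaussWeight ν)
      (Filter.Eventually.of_forall fun z => ENNReal.ofReal_lt_top)]
  obtain ⟨C, hC, h⟩ := poly_bound p (ν / 4) (by positivity)
  have hgi : Integrable (fun z : CSp d => Real.exp (-(ν / 2) * ‖z‖ ^ 2)) := by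
    have := (GaussianFourier.integrable_cexp_neg_mul_sq_norm_add (V := CSp d)
      (b := ((ν / 2 : ℝ) : ℂ)) (by simpa using hν) 0 0).norm
    refine this.congr (Filter.Eventually.of_forall fun z => ?_)
    simp [Complex.norm_exp, ← Complex.ofReal_pow, Complex.mul_re, -Complex.ofReal_div]
  refine (hgi.const_mul ((ν / Real.pi) ^ d * C ^ 2)).mono' ?_
    (Filter.Eventually.of_forall fun z => ?_)
  · exact ((measurable_gaussWeight ν).ennreal_toReal.aestronglyMeasurable.smul
      (hc.norm.pow 2).aestronglyMeasurable)
  · rw [ENNReal.toReal_ofReal (gaussWeight_pos hν z).le, smul_eq_mul, norm_mul,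
      Real.norm_of_nonneg (gaussWeight_pos hν z).le, Real.norm_of_nonneg (by positivity),
      gaussWeight]
    have h1 : ‖MvPolynomial.eval z.ofLp p‖ ^ 2 ≤ (C * Real.exp (ν / 4 * ‖z‖ ^ 2)) ^ 2 := by
      gcongr; exact h z
    calc _ ≤ (ν / Real.pi) ^ d * Real.exp (-ν * ‖z‖ ^ 2) *
          (C * Real.exp (ν / 4 * ‖z‖ ^ 2)) ^ 2 := by gcongr
      _ = (ν / Real.pi) ^ d * C ^ 2 * (Real.exp (-ν * ‖z‖ ^ 2) *
          Real.exp ((2 : ℕ) * (ν / 4 * ‖z‖ ^ 2))) := by rw [Real.exp_nat_mul]; ring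
      _ = _ := by rw [← Real.exp_add]; congr 2; push_cast; ring

/-- A holomorphic polynomial, as an element of the Fock space. -/
def fockPoly {ν : ℝ} (hν : 0 < ν) (p : MvPolynomial (Fin d) ℂ) : fockSpace d ν :=
  ⟨(memLp_eval hν p).toLp _, fun z => MvPolynomial.eval z.ofLp p, differentiable_eval p,
    (memLp_eval hν p).coeFn_toLp⟩

end Fock

/-! ### Polar decomposition -/

section Polar
variable {X Y : Type*} [NormedAddCommGroup X] [InnerProductSpace ℂ X] [CompleteSpace X]
  [NormedAddCommGroup Y] [InnerProductSpace ℂ Y] [CompleteSpace Y]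

/-- `|T| = (T T*)^{1/2}`. -/
def absOp (T : X →L[ℂ] Y) : Y →L[ℂ] Y := CFC.sqrt (T ∘L ContinuousLinearMap.adjoint T)

theorem absOp_nonneg (T : X →L[ℂ] Y) : 0 ≤ absOp T := CFC.sqrt_nonneg _

theorem absOp_isSelfAdjoint (T : X →L[ℂ] Y) : IsSelfAdjoint (absOp T) :=
  (absOp_nonneg T).isSelfAdjoint

theorem absOp_mul_self (T : X →L[ℂ] Y) :
    absOp T * absOp T = T ∘L ContinuousLinearMap.adjoint T := by
  refine CFC.sqrt_mul_sqrt_self _ ?_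
  rw [ContinuousLinearMap.nonneg_iff_isPositive]
  exact ContinuousLinearMap.isPositive_self_comp_adjoint T

theorem norm_absOp_apply (T : X →L[ℂ] Y) (y : Y) :
    ‖absOp T y‖ = ‖ContinuousLinearMap.adjoint T y‖ := by
  have h : (inner ℂ (absOp T y) (absOp T y)) =
      inner ℂ (ContinuousLinearMap.adjoint T y) (ContinuousLinearMap.adjoint T y) := by
    have hsa := ContinuousLinearMap.isSelfAdjoint_iff'.1 (absOp_isSelfAdjoint T)
    conv_lhs => rw [← ContinuousLinearMap.adjoint_inner_left, hsa]
    have h2 : absOp T (absOp T y) = T (ContinuousLinearMap.adjoint T y) := by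
      have := congrArg (fun A : Y →L[ℂ] Y => A y) (absOp_mul_self T)
      simpa using this
    rw [h2, ContinuousLinearMap.adjoint_inner_right]
  rw [inner_self_eq_norm_sq_to_K, inner_self_eq_norm_sq_to_K] at h
  have h' : ‖absOp T y‖ ^ 2 = ‖ContinuousLinearMap.adjoint T y‖ ^ 2 := by exact_mod_cast h
  exact (pow_left_inj₀ (norm_nonneg _) (norm_nonneg _) two_ne_zero).1 h'

/-- The polar decomposition `T = |T| U` with `|T| = (T T*)^{1/2}` and `U` the partial isometry
with initial space `(ker T)ᗮ`. -/
structure IsPolarPart (T : X →L[ℂ] Y) (U : X →L[ℂ] Y) : Prop where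
  absOp_apply : ∀ x, absOp T (U x) = T x
  norm_map : ∀ x ∈ T.kerᗮ, ‖U x‖ = ‖x‖
  map_ker : ∀ x ∈ T.ker, U x = 0

theorem exists_isPolarPart (T : X →L[ℂ] Y) : ∃ U, IsPolarPart T U := by
  set A := absOp T with hA
  set M : Submodule ℂ Y := A.range.topologicalClosure with hM
  have hmem : ∀ y, A y ∈ M := fun y => A.range.le_topologicalClosure ⟨y, rfl⟩
  let e : Y →ₗ[ℂ] M := A.toLinearMap.codRestrict M hmem
  have he : DenseRange e := by
    rw [DenseRange, dense_iff_closure_eq, Set.eq_univ_iff_forall]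
    rintro ⟨m, hm⟩
    rw [closure_subtype]
    have : (Subtype.val '' Set.range e) = (A.range : Set Y) := by
      ext z; constructor
      · rintro ⟨_, ⟨y, rfl⟩, rfl⟩; exact ⟨y, rfl⟩
      · rintro ⟨y, rfl⟩; exact ⟨e y, ⟨y, rfl⟩, rfl⟩
    rw [this]
    exact hm
  have hn : ∀ y, ‖(ContinuousLinearMap.adjoint T).toLinearMap y‖ ≤ 1 * ‖e y‖ := by
    intro y
    rw [one_mul]
    exact (norm_absOp_apply T y).ge
  have : CompleteSpace M := (A.range.isClosed_topologicalClosure).completeSpace_coe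
  let V0 : M →L[ℂ] X := (ContinuousLinearMap.adjoint T).toLinearMap.extendOfNorm e
  have hV0 : ∀ y, V0 (e y) = ContinuousLinearMap.adjoint T y :=
    fun y => LinearMap.extendOfNorm_eq he ⟨1, hn⟩ y
  have hV0n : ∀ m, ‖V0 m‖ = ‖m‖ := by
    intro m
    refine he.induction_on (p := fun m => ‖V0 m‖ = ‖m‖) m
      (isClosed_eq (V0.continuous.norm) continuous_norm) ?_
    intro y
    rw [hV0]
    exact (norm_absOp_apply T y).symm
  let V0i : M →ₗᵢ[ℂ] X := ⟨V0.toLinearMap, hV0n⟩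
  let V : Y →L[ℂ] X := V0 ∘L M.orthogonalProjectionOnto
  have hVA : V ∘L A = ContinuousLinearMap.adjoint T := by
    ext y
    have : M.orthogonalProjectionOnto (A y) = e y :=
      Submodule.orthogonalProjectionOnto_mem_subspace_eq_self (e y)
    change V0 (M.orthogonalProjectionOnto (A y)) = _
    rw [this, hV0]
  have hsa : ContinuousLinearMap.adjoint A = A :=
    ContinuousLinearMap.isSelfAdjoint_iff'.1 (absOp_isSelfAdjoint T)
  have hAU : A ∘L ContinuousLinearMap.adjoint V = T := by
    have := congrArg ContinuousLinearMap.adjoint hVA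
    rwa [ContinuousLinearMap.adjoint_comp, hsa, ContinuousLinearMap.adjoint_adjoint] at this
  have hUV : ∀ m : M, ContinuousLinearMap.adjoint V (V0 m) = m := by
    intro m
    refine ext_inner_right ℂ fun z => ?_
    rw [ContinuousLinearMap.adjoint_inner_left]
    change inner ℂ (V0i m) (V0i (M.orthogonalProjectionOnto z)) = _
    rw [V0i.inner_map_map]
    exact Submodule.inner_orthogonalProjectionOnto_eq_of_mem_left m z
  refine ⟨ContinuousLinearMap.adjoint V, fun x => congrArg (fun B : X →L[ℂ] Y => B x) hAU, ?_, ?_⟩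
  · intro x hx
    -- `x` lies in the closed range of `V0`
    have hcl : IsClosed (V0i.toLinearMap.range : Set X) := by
      have := V0i.isometry.isClosedEmbedding.isClosed_range
      convert this using 1
      exact LinearMap.coe_range _
    have hxr : x ∈ V0i.toLinearMap.range := by
      have : CompleteSpace V0i.toLinearMap.range := hcl.completeSpace_coe
      rw [← Submodule.orthogonal_orthogonal V0i.toLinearMap.range]
      rw [Submodule.mem_orthogonal]
      intro w hw
      refine (Submodule.mem_orthogonal _ _).1 hx w ?_
      change T w = 0
      refine ext_inner_left ℂ fun y => ?_
      rw [inner_zero_right, ← ContinuousLinearMap.adjoint_inner_left, ← hV0]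
      exact (Submodule.mem_orthogonal _ _).1 hw _ ⟨e y, rfl⟩
    obtain ⟨m, rfl⟩ := hxr
    change ‖ContinuousLinearMap.adjoint V (V0 m)‖ = ‖V0 m‖
    rw [hUV, hV0n]; rfl
  · intro x hx
    have hx' : T x = 0 := hx
    refine ext_inner_right ℂ fun z => ?_
    rw [ContinuousLinearMap.adjoint_inner_left, inner_zero_left]
    change inner ℂ (x) (V0 (M.orthogonalProjectionOnto z)) = 0
    refine he.induction_on (p := fun m => inner ℂ (x) (V0 m) = 0) (M.orthogonalProjectionOnto z)
      (isClosed_eq (continuous_const.inner V0.continuous) continuous_const) ?_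
    intro y
    rw [hV0, ContinuousLinearMap.adjoint_inner_right, hx', inner_zero_left]

/-- The partially isometric factor `U` of the polar decomposition `T = |T| U`. -/
def polarPart (T : X →L[ℂ] Y) : X →L[ℂ] Y := Classical.choose (exists_isPolarPart T)

theorem isPolarPart_polarPart (T : X →L[ℂ] Y) : IsPolarPart T (polarPart T) :=
  Classical.choose_spec (exists_isPolarPart T)

end Polar

/-! ### Jordan triple systems -/

section Triple
variable {E : Type*} [AddCommGroup E]

/-- Tripotents of a triple product normalised by `{x y z} = (Q(x+z) - Q(x) - Q(z)) y`: the
condition `Q(e) e = e` reads `{e e e} = 2 e`. -/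
def IsTripotent (t : E → E → E → E) (e : E) : Prop := t e e e = e + e

/-- Two elements are orthogonal if `D(u, v) = 0`. -/
def TripleOrthogonal (t : E → E → E → E) (u v : E) : Prop := ∀ z, t u v z = 0

/-- Minimal (= primitive) tripotents: nonzero tripotents which are not the sum of two nonzero
orthogonal tripotents. -/
structure IsMinimalTripotent (t : E → E → E → E) (e : E) : Prop where
  ne_zero : e ≠ 0
  tripotent : IsTripotent t e
  primitive : ∀ u v, IsTripotent t u → IsTripotent t v → TripleOrthogonal t u v → e = u + v →
    u = 0 ∨ v = 0

end Triple

/-- Coordinatewise complex conjugation on `ℂ^d`: the conjugation `τ` with fixed space `ℝ^d`. -/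
def conjVec {d : ℕ} (z : CSp d) : CSp d := WithLp.toLp 2 fun j => starRingEnd ℂ (z j)

/-- Coordinatewise real part. -/
def reVec {d : ℕ} : CSp d →ₗ[ℝ] RSp d where
  toFun z := WithLp.toLp 2 fun j => (z j).re
  map_add' x y := by ext j; simp
  map_smul' c x := by ext j; simp

/-- An irreducible bounded symmetric domain of tube type in `V_ℂ` together with a real form `V`,
given by the associated simple positive Hermitian Jordan triple system.  The `K`-invariant
inner product of `V_ℂ` is normalised so that minimal tripotents have norm one, and orthonormal
coordinates of `V` are used, so that `V = ℝ^d`, `V_ℂ = ℂ^d` with their standard inner products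
and `τ` is the coordinatewise conjugation. -/
structure RealJordanForm (d : ℕ) where
  /-- the triple product `{x ȳ z}`, linear in `x`, `z` and conjugate linear in `y` -/
  triple : CSp d →ₗ[ℂ] CSp d →ₗ⋆[ℂ] CSp d →ₗ[ℂ] CSp d
  symm : ∀ x y z, triple x y z = triple z y x
  jordan : ∀ x y u v w, triple x y (triple u v w) =
    triple (triple x y u) v w - triple u (triple y x v) w + triple u v (triple x y w)
  /-- the trace form is positive definite -/
  pos : ∀ x, x ≠ 0 → 0 < (LinearMap.trace ℂ (CSp d) (triple x x)).re
  /-- the triple system is simple: the domain is irreducible -/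
  nontrivial : d ≠ 0
  simple : ∀ I : Submodule ℂ (CSp d),
    (∀ x ∈ I, ∀ y z, triple x y z ∈ I ∧ triple y x z ∈ I) → I = ⊥ ∨ I = ⊤
  /-- the domain is of tube type: some tripotent has all of `ℂ^d` as its Peirce `2`-space -/
  tube : ∃ e, IsTripotent (fun x y z => triple x y z) e ∧ ∀ x, triple e e x = x + x
  /-- the conjugation `τ` preserves the triple product, hence the domain -/
  conj_triple : ∀ x y z, conjVec (triple x y z) = triple (conjVec x) (conjVec y) (conjVec z)
  /-- the inner product is invariant under the automorphisms of the triple system -/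
  norm_invariant : ∀ k : CSp d ≃ₗ[ℂ] CSp d,
    (∀ x y z, k (triple x y z) = triple (k x) (k y) (k z)) → ∀ x, ‖k x‖ = ‖x‖
  /-- minimal tripotents of `ℂ^d` have norm one -/
  norm_minimal : ∀ e, IsMinimalTripotent (fun x y z => triple x y z) e → ‖e‖ = 1

namespace RealJordanForm
variable {d : ℕ} (T : RealJordanForm d)

/-- The triple product of the real form `V = ℝ^d`. -/
def rtriple (x y z : RSp d) : RSp d := reVec (T.triple (incl x) (incl y) (incl z))

/-- The action of a real orthogonal matrix on `ℝ^d`. -/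
def _root_.SegalBargmann.actR {d : ℕ} (k : Matrix.orthogonalGroup (Fin d) ℝ) (x : RSp d) : RSp d :=
  WithLp.toLp 2 ((k : Matrix (Fin d) (Fin d) ℝ).mulVec x.ofLp)

/-- The complex linear extension of the action to `ℂ^d`. -/
def _root_.SegalBargmann.actC {d : ℕ} (k : Matrix.orthogonalGroup (Fin d) ℝ) (z : CSp d) : CSp d :=
  WithLp.toLp 2 (((k : Matrix (Fin d) (Fin d) ℝ).map (fun t : ℝ => (t : ℂ))).mulVec z.ofLp)

theorem _root_.SegalBargmann.actC_one {d : ℕ} (z : CSp d) : actC 1 z = z := by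
  have : ((1 : Matrix (Fin d) (Fin d) ℝ).map (fun t : ℝ => (t : ℂ))) = 1 :=
    Matrix.map_one _ Complex.ofReal_zero Complex.ofReal_one
  simp [actC, this]

theorem _root_.SegalBargmann.actC_mul {d : ℕ} (k l : Matrix.orthogonalGroup (Fin d) ℝ) (z : CSp d) :
    actC (k * l) z = actC k (actC l z) := by
  have : (((k : Matrix (Fin d) (Fin d) ℝ) * (l : Matrix (Fin d) (Fin d) ℝ)).map
      (fun t : ℝ => (t : ℂ))) = (k : Matrix (Fin d) (Fin d) ℝ).map (fun t : ℝ => (t : ℂ)) *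
        (l : Matrix (Fin d) (Fin d) ℝ).map (fun t : ℝ => (t : ℂ)) :=
    Matrix.map_mul (f := Complex.ofRealHom)
  simp [actC, this]

/-- The group of the automorphisms of `ℂ^d` that commute with `τ`; they are given by
real orthogonal matrices as the inner product is invariant. -/
def realAut : Subgroup (Matrix.orthogonalGroup (Fin d) ℝ) where
  carrier := {k | ∀ x y z, actC k (T.triple x y z) = T.triple (actC k x) (actC k y) (actC k z)}
  one_mem' := fun x y z => by simp only [actC_one]
  mul_mem' := by
    intro k l hk hl x y z
    rw [actC_mul, hl, hk, actC_mul, actC_mul, actC_mul]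
  inv_mem' := by
    intro k hk x y z
    have h : ∀ w, actC k (actC k⁻¹ w) = w := fun w => by rw [← actC_mul, mul_inv_cancel, actC_one]
    have h' : ∀ w, actC k⁻¹ (actC k w) = w := fun w => by
      rw [← actC_mul, inv_mul_cancel, actC_one]
    rw [← h' (T.triple (actC k⁻¹ x) (actC k⁻¹ y) (actC k⁻¹ z)), hk, h, h, h]

/-- The group `L`: the identity component. -/
abbrev L : Type := Subgroup.connectedComponentOfOne T.realAut

/-- The action of `L` on `V`. -/
def act (l : T.L) (x : RSp d) : RSp d := actR l.1.1 x

instance compactOrthogonal : CompactSpace (Matrix.orthogonalGroup (Fin d) ℝ) := by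
  refine isCompact_iff_compactSpace.1 ?_
  have h1 : IsCompact (Set.univ.pi fun _ => Set.univ.pi fun _ => Metric.closedBall 0 1 :
      Set (Fin d → Fin d → ℝ)) :=
    isCompact_univ_pi fun _ => isCompact_univ_pi fun _ => isCompact_closedBall 0 1
  refine IsCompact.of_isClosed_subset (X := Matrix (Fin d) (Fin d) ℝ) h1 ?_ ?_
  · exact isClosed_unitary
  · intro k hk i _ j _
    exact mem_closedBall_zero_iff.2 (entry_norm_bound_of_unitary hk i j)

theorem triple_expand (x y z : CSp d) : T.triple x y z = ∑ i, ∑ j, ∑ k,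
    (x i * starRingEnd ℂ (y j) * z k) • T.triple (EuclideanSpace.single i 1)
      (EuclideanSpace.single j 1) (EuclideanSpace.single k 1) := by
  have h : ∀ w : CSp d, w = ∑ i, w i • EuclideanSpace.single i (1 : ℂ) := by
    intro w
    ext i
    simp [Finset.sum_apply, Pi.single_apply]
  have hx : ∀ v w, T.triple x v w = ∑ i, x i • T.triple (EuclideanSpace.single i 1) v w := by
    intro v w
    conv_lhs => rw [h x]
    simp only [map_sum, LinearMap.sum_apply, map_smul, LinearMap.smul_apply]
  have hy : ∀ u w, T.triple u y w =
      ∑ j, starRingEnd ℂ (y j) • T.triple u (EuclideanSpace.single j 1) w := by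
    intro u w
    conv_lhs => rw [h y]
    simp only [map_sum, LinearMap.sum_apply, LinearMap.map_smulₛₗ, LinearMap.smul_apply]
  have hz : ∀ u v, T.triple u v z = ∑ k, z k • T.triple u v (EuclideanSpace.single k 1) := by
    intro u v
    conv_lhs => rw [h z]
    simp only [map_sum, map_smul]
  rw [hx]
  refine Finset.sum_congr rfl fun i _ => ?_
  rw [hy, Finset.smul_sum]
  refine Finset.sum_congr rfl fun j _ => ?_
  rw [hz, Finset.smul_sum, Finset.smul_sum]
  refine Finset.sum_congr rfl fun k _ => ?_
  rw [smul_smul, smul_smul]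

theorem isClosed_realAut : IsClosed (T.realAut : Set (Matrix.orthogonalGroup (Fin d) ℝ)) := by
  have hact : ∀ w : CSp d, Continuous fun k : Matrix.orthogonalGroup (Fin d) ℝ => actC k w := by
    intro w
    unfold actC
    refine (PiLp.continuous_toLp 2 _).comp ?_
    refine Continuous.matrix_mulVec ?_ continuous_const
    exact (continuous_subtype_val.matrix_map Complex.continuous_ofReal)
  have : (T.realAut : Set (Matrix.orthogonalGroup (Fin d) ℝ)) = ⋂ x, ⋂ y, ⋂ z,
      {k | actC k (T.triple x y z) = T.triple (actC k x) (actC k y) (actC k z)} := by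
    ext k; simp [realAut]
  rw [this]
  refine isClosed_iInter fun x => isClosed_iInter fun y => isClosed_iInter fun z => ?_
  refine isClosed_eq (hact _) ?_
  simp only [T.triple_expand (actC _ x)]
  have hc : ∀ w i, Continuous fun k : Matrix.orthogonalGroup (Fin d) ℝ => (actC k w) i :=
    fun w i => (PiLp.continuous_apply 2 _ i).comp (hact w)
  refine continuous_finsetSum _ fun i _ => continuous_finsetSum _ fun j _ =>
    continuous_finsetSum _ fun k _ => ?_
  exact (((hc x i).mul (Complex.continuous_conj.comp (hc y j))).mul (hc z k)).smul continuous_const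

instance : CompactSpace T.realAut := isCompact_iff_compactSpace.1 T.isClosed_realAut.isCompact

instance : CompactSpace T.L :=
  isCompact_iff_compactSpace.1 (isClosed_connectedComponent (x := (1 : T.realAut))).isCompact

instance : MeasurableSpace T.L := borel _
instance : BorelSpace T.L := ⟨rfl⟩

/-- The normalised Haar measure of `L`. -/
def haarL : Measure T.L := Measure.haarMeasure ⊤

instance : IsProbabilityMeasure T.haarL := by
  refine ⟨?_⟩
  have := Measure.haarMeasure_self (K₀ := (⊤ : TopologicalSpace.PositiveCompacts T.L))
  simpa [haarL] using this

end RealJordanForm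

/-! ### Frames and restricted roots -/

namespace RealJordanForm
variable {d r : ℕ} (T : RealJordanForm d)

/-- A frame of `V`: a maximal family of pairwise orthogonal minimal tripotents of `V`. -/
structure IsFrame (e : Fin r → RSp d) : Prop where
  minimal : ∀ j, IsMinimalTripotent T.rtriple (e j)
  orthogonal : ∀ j k, j ≠ k → TripleOrthogonal T.rtriple (e j) (e k)
  maximal : ∀ u, IsTripotent T.rtriple u → (∀ j, TripleOrthogonal T.rtriple (e j) u) → u = 0

theorem rtriple_add₁ (x x' y z : RSp d) :
    T.rtriple (x + x') y z = T.rtriple x y z + T.rtriple x' y z := by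
  simp [rtriple]

theorem rtriple_add₂ (x y y' z : RSp d) :
    T.rtriple x (y + y') z = T.rtriple x y z + T.rtriple x y' z := by
  simp [rtriple]

theorem incl_smul (c : ℝ) (x : RSp d) : incl (c • x) = (c : ℂ) • incl x := by
  ext j; simp [incl]

theorem rtriple_smul₁ (c : ℝ) (x y z : RSp d) :
    T.rtriple (c • x) y z = c • T.rtriple x y z := by
  unfold rtriple
  rw [incl_smul, LinearMap.map_smul, LinearMap.smul_apply, LinearMap.smul_apply,
    Complex.coe_smul, map_smul]

theorem rtriple_smul₂ (c : ℝ) (x y z : RSp d) :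
    T.rtriple x (c • y) z = c • T.rtriple x y z := by
  unfold rtriple
  rw [incl_smul, LinearMap.map_smulₛₗ, LinearMap.smul_apply, Complex.conj_ofReal,
    Complex.coe_smul, map_smul]

/-- The Lie algebra of `L`: derivations of the triple system `V`. -/
def IsDerivation (δ : RSp d →ₗ[ℝ] RSp d) : Prop := ∀ x y z,
  δ (T.rtriple x y z) = T.rtriple (δ x) y z + T.rtriple x (δ y) z + T.rtriple x y (δ z)

/-- Root spaces of `𝔥 = 𝔮 + 𝔩` with respect to `𝔞`.  A pair `(v, δ)` stands for the vector field
`ξ_v + δ` on `V`, with `ξ_v(x) = v - Q(x) v` and `δ` a derivation.  The vector field bracket is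
`[ξ_h, ξ_v] = D(v, h) - D(h, v)` and `[ξ_h, δ] = ξ_{δ h}`.  The functional on `𝔞` with value `c j`
at `ξ_{e j}` has as its root space all `X` with `[ξ_{e j}, X] = c j X` for every `j`. -/
def rootSpace (e : Fin r → RSp d) (c : Fin r → ℝ) :
    Submodule ℝ (RSp d × (RSp d →ₗ[ℝ] RSp d)) where
  carrier := {X | T.IsDerivation X.2 ∧ ∀ j, X.2 (e j) = c j • X.1 ∧
    ∀ z, T.rtriple X.1 (e j) z - T.rtriple (e j) X.1 z = c j • X.2 z}
  add_mem' := by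
    rintro ⟨v, δ⟩ ⟨v', δ'⟩ ⟨h1, h2⟩ ⟨h1', h2'⟩
    refine ⟨fun x y z => ?_, fun j => ⟨?_, fun z => ?_⟩⟩
    · have a := h1 x y z
      have b := h1' x y z
      simp only [Prod.snd_add, LinearMap.add_apply, rtriple_add₁, rtriple_add₂]
      simp only at a b
      rw [a, b]
      have : ∀ u u', T.rtriple x y (u + u') = T.rtriple x y u + T.rtriple x y u' := by
        intro u u'; simp [rtriple]
      rw [this]; abel
    · have a := (h2 j).1
      have b := (h2' j).1
      simp only at a b
      simp [a, b]
    · have a := (h2 j).2 z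
      have b := (h2' j).2 z
      simp only [Prod.fst_add, Prod.snd_add, LinearMap.add_apply, rtriple_add₁, rtriple_add₂,
        smul_add]
      simp only at a b
      rw [← a, ← b]; abel
  zero_mem' := by
    refine ⟨fun x y z => ?_, fun j => ⟨?_, fun z => ?_⟩⟩ <;> simp [rtriple]
  smul_mem' := by
    rintro s ⟨v, δ⟩ ⟨h1, h2⟩
    refine ⟨fun x y z => ?_, fun j => ⟨?_, fun z => ?_⟩⟩
    · have a := h1 x y z
      simp only [Prod.smul_snd, LinearMap.smul_apply, rtriple_smul₁, rtriple_smul₂]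
      simp only at a
      have : ∀ u, T.rtriple x y (s • u) = s • T.rtriple x y u := by
        intro u
        simp [rtriple]
      rw [a, this, smul_add, smul_add]
    · have a := (h2 j).1
      simp only [Prod.smul_snd, Prod.smul_fst, LinearMap.smul_apply]
      simp only at a
      rw [a, smul_comm]
    · have a := (h2 j).2 z
      simp only [Prod.smul_fst, Prod.smul_snd, LinearMap.smul_apply, rtriple_smul₁, rtriple_smul₂]
      simp only at a
      rw [← smul_sub, a, smul_comm]

/-- `c` is a restricted root. -/
def IsRoot (e : Fin r → RSp d) (c : Fin r → ℝ) : Prop := c ≠ 0 ∧ T.rootSpace e c ≠ ⊥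

/-- Root multiplicities. -/
def rootMultiplicity (e : Fin r → RSp d) (c : Fin r → ℝ) : ℕ := Module.finrank ℝ (T.rootSpace e c)

/-- `c = ± β_j`, where `β_j(ξ_k) = 2 δ_{jk}`. -/
def IsLongRoot (c : Fin r → ℝ) : Prop := ∃ j, c = Pi.single j 2 ∨ c = Pi.single j (-2)

/-- `c = (± β_j ± β_k) / 2` with `j ≠ k`. -/
def IsShortRoot (c : Fin r → ℝ) : Prop := ∃ j k, j ≠ k ∧ ∃ s t : ℝ, (s = 1 ∨ s = -1) ∧
  (t = 1 ∨ t = -1) ∧ c = Pi.single j s + Pi.single k t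

/-- The root system is of type `C_r`. -/
def IsTypeC (e : Fin r → RSp d) : Prop := ∀ c, T.IsRoot e c ↔ IsLongRoot c ∨ IsShortRoot c

/-- The root system is of type `D_r`, `r ≥ 3`. -/
def IsTypeD (e : Fin r → RSp d) : Prop := 3 ≤ r ∧ ∀ c, T.IsRoot e c ↔ IsShortRoot c

end RealJordanForm

/-! ### Jack polynomials -/

section Jack
variable {r : ℕ}

/-- The Dunkl operator of type `A`, on functions on the set of points of `ℝ^r` with pairwise
distinct coordinates (values at other points are irrelevant). -/
def dunklA (a : ℝ) (j : Fin r) (f : (Fin r → ℝ) → ℝ) (y : Fin r → ℝ) : ℝ :=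
  deriv (fun t => f (Function.update y j t)) (y j) +
    a / 2 * ∑ i ∈ Finset.univ.erase j, (f y - f (y ∘ Equiv.swap i j)) / (y j - y i)

/-- The Cherednik operator `U_j = D_j y_j - (a/2) ∑_{i<j} s_{ij}` of type `A`. -/
def cherednikA (a : ℝ) (j : Fin r) (f : (Fin r → ℝ) → ℝ) (y : Fin r → ℝ) : ℝ :=
  dunklA a j (fun w => w j * f w) y -
    a / 2 * ∑ i ∈ Finset.univ.filter (· < j), f (y ∘ Equiv.swap i j)

/-- The operator `∏_j (U_j + α)`. -/
def cherednikProd (a α : ℝ) (f : (Fin r → ℝ) → ℝ) : (Fin r → ℝ) → ℝ :=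
  (List.finRange r).foldr (fun j g y => cherednikA a j g y + α * g y) f

/-- `Ω` is the Jack symmetric polynomial `Ω_m` normalised by `Ω_m(1, …, 1) = 1`. -/
structure IsJack (a : ℝ) (m : Fin r → ℕ) (Ω : MvPolynomial (Fin r) ℝ) : Prop where
  isSymmetric : Ω.IsSymmetric
  eigen : ∀ (α : ℕ) (y : Fin r → ℝ), Function.Injective y →
    cherednikProd a α (fun w => MvPolynomial.eval w Ω) y =
      (∏ k : Fin r, (a / 2 * ((r : ℝ) - (k + 1)) + 1 + α + m k)) * MvPolynomial.eval y Ω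
  normalized : MvPolynomial.eval (fun _ => 1) Ω = 1

end Jack

namespace RealJordanForm
variable {d r : ℕ} (T : RealJordanForm d)

/-- The signature `(m_1, m_1, m_2, m_2, …, m_r, m_r)`. -/
def signatureC (m : Fin r → ℕ) : List ℕ := (List.ofFn m).flatMap fun k => [k, k]

/-- The signature `(2 m_1 + m₀, …, 2 m_r + m₀)`. -/
def signatureD (m : Fin r → ℕ) (m₀ : ℕ) : List ℕ := List.ofFn fun j => 2 * m j + m₀

/-- `p` is an `L`-invariant polynomial on `ℂ^d`, homogeneous of degree `N`, and its restriction
to `𝔞`, in the coordinates `x ↦ ∑ x_j e_j`, is `q`. -/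
structure IsInvariantExtension (e : Fin r → RSp d) (N : ℕ) (q : (Fin r → ℝ) → ℝ)
    (p : MvPolynomial (Fin d) ℂ) : Prop where
  isHomogeneous : p.IsHomogeneous N
  invariant : ∀ (l : T.L) (z : CSp d),
    MvPolynomial.eval (actC l.1.1 z).ofLp p = MvPolynomial.eval z.ofLp p
  restrict : ∀ x : Fin r → ℝ,
    MvPolynomial.eval (incl (∑ j, x j • e j)).ofLp p = ((q x : ℝ) : ℂ)

/-- `p` is the spherical polynomial `p_n`, for a spherical signature `n`, where `a` is the
multiplicity of the roots `(β_j - β_k) / 2`. -/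
def IsSphericalPolynomial (e : Fin r → RSp d) (a : ℕ) (n : List ℕ)
    (p : MvPolynomial (Fin d) ℂ) : Prop :=
  (T.IsTypeC e ∧ ∃ (m : Fin r → ℕ) (Ω : MvPolynomial (Fin r) ℝ), Antitone m ∧ IsJack a m Ω ∧
    n = signatureC m ∧ T.IsInvariantExtension e n.sum
      (fun x => MvPolynomial.eval (fun j => x j ^ 2) Ω) p) ∨
  (T.IsTypeD e ∧ ∃ (m : Fin r → ℕ) (m₀ : ℕ) (Ω : MvPolynomial (Fin r) ℝ), Antitone m ∧
    IsJack a m Ω ∧ n = signatureD m m₀ ∧ T.IsInvariantExtension e n.sum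
      (fun x => (∏ j, x j) ^ m₀ * MvPolynomial.eval (fun j => x j ^ 2) Ω) p)

/-! ### Bessel functions, Hermite polynomials, the two transforms -/

/-- The subspace `𝔞 = ℝ e_1 + ⋯ + ℝ e_r` of `V`. -/
abbrev cartan (e : Fin r → RSp d) : Submodule ℝ (RSp d) := Submodule.span ℝ (Set.range e)

/-- A functional on `𝔞`, extended to `V` by the orthogonal projection. -/
def extendFunctional {e : Fin r → RSp d} (lam : StrongDual ℝ (cartan e)) (x : RSp d) : ℝ :=
  lam ((cartan e).orthogonalProjectionOnto x)

/-- The Bessel function `J_λ(x) = ∫_L e^{-i λ(l x)} dl`. -/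
def bessel {e : Fin r → RSp d} (lam : StrongDual ℝ (cartan e)) (x : RSp d) : ℂ :=
  ∫ l, Complex.exp (-Complex.I * extendFunctional lam (T.act l x)) ∂T.haarL

end RealJordanForm

section Transforms
variable {d r : ℕ}

/-- The partial derivative in the `j`-th coordinate. -/
def partialDeriv (j : Fin d) (f : RSp d → ℂ) (x : RSp d) : ℂ :=
  lineDeriv ℝ f x (EuclideanSpace.single j 1)

/-- The partial derivative of multi-index `s`. -/
def multiDeriv (s : Fin d →₀ ℕ) (f : RSp d → ℂ) : RSp d → ℂ :=
  (List.finRange d).foldr (fun j g => (partialDeriv j)^[s j] g) f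

/-- `p(∂_x) f`: replace `x_j` by `∂_j` in `p`. -/
def polyDeriv (p : MvPolynomial (Fin d) ℂ) (f : RSp d → ℂ) (x : RSp d) : ℂ :=
  ∑ s ∈ p.support, p.coeff s * multiDeriv s f x

/-- The Hermite polynomial `ζ_{n,ν}(λ) = ‖p‖⁻² p(∂_x)(e^{ν|x|²/2} J_λ(x))|_{x=0}` for `p = p_n`, with
the norm of the Fock space `𝓕 = 𝓕_1`. -/
def hermite (T : RealJordanForm d) {e : Fin r → RSp d} (p : MvPolynomial (Fin d) ℂ) (ν : ℝ)
    (lam : StrongDual ℝ (RealJordanForm.cartan e)) : ℂ :=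
  1 / ((‖fockPoly one_pos p‖ ^ 2 : ℝ) : ℂ) *
    polyDeriv p (fun x => (Real.exp (ν / 2 * ‖x‖ ^ 2) : ℂ) * T.bessel lam x) 0

/-- The Segal-Bargmann transform `U : 𝓕_ν → L²(V)`, the isometric factor in `R = |R| U`. -/
def segalBargmann {ν : ℝ} (hν : 0 < ν) :
    fockSpace d ν →L[ℂ] Lp ℂ 2 (volume : Measure (RSp d)) :=
  have : CompleteSpace (fockSpace d ν) := (isClosed_fockSpace hν).completeSpace_coe
  polarPart (restrictOp hν)

/-- The Fourier transform on `V`, evaluated at `λ ∈ 𝔞*`. -/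
def fourierOnCartan {e : Fin r → RSp d} (f : RSp d → ℂ)
    (lam : StrongDual ℝ (RealJordanForm.cartan e)) : ℂ :=
  ∫ x, f x * Complex.exp (Complex.I * RealJordanForm.extendFunctional lam x)

end Transforms

end SegalBargmann

end

namespace SegalBargmann
variable {d : ℕ} {ν : ℝ}

/-! Two computations express both sides through the same Fourier integral, that of `p(x)
exp(-ν‖x‖²/2)`.

Left side. By the reproducing kernel `exp(ν⟨z, w⟩)` of the Fock space, `R R*` is convolution with
`exp(-ν‖x‖²/2)`. Gaussians form a convolution semigroup, so by uniqueness of positive square roots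
`|R|` is `(2ν/π)^(d/4)` times convolution with `exp(-ν‖x‖²)` (`absOp_restrictOp`). This operator is
injective, hence `U p` is the only solution of `|R| U p = R p`. Integration by parts shows that
convolving `exp(-ν‖y‖²)` times polynomials with that Gaussian reaches every polynomial multiple of
`exp(-ν‖x‖²/2)`. So `U p` is a polynomial times `exp(-ν‖x‖²)`, which gives integrability. The
Fourier transform turns the convolution into a product and yields, at the vector `l` representing
`λ`, `(2π/ν)^(-d/4) exp(‖l‖²/(4ν))` times the Fourier integral of `R p`
(`fourier_segalBargmann_fockPoly`).

Right side. Up to the constant `(2π/ν)^(d/2) exp(-‖l‖²/(2ν))`, the function `exp(ν‖x‖²/2) J_λ(x)` is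
the Laplace transform at `νx` of `exp(-ν‖y‖²/2)` times the `L`-average of the plane wave `exp(i⟨l,
y⟩)`. Applying `p(∂_x)` at `0` under the integral inserts `p(y)` and, `p` being homogeneous, the
factor `(-ν)^N` with `N` the degree of `p`; as `p` is `L`-invariant, the average may be replaced by
the plane wave itself (`polyDeriv_exp_mul_bessel`). Comparing constants gives the formula. Thus the
properties of `p_n` that enter are homogeneity, `L`-invariance and `p ≠ 0`, the last from its value
`1` at `e_1 + ⋯ + e_r`. -/

/-! ### The Gaussian measure and the reproducing kernel of the Fock space. -/

theorem integral_fockMeasure (hν : 0 < ν) (F : CSp d → ℂ) :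
    ∫ z, F z ∂fockMeasure d ν = ∫ z, (gaussWeight d ν z : ℂ) * F z := by
  rw [fockMeasure, integral_withDensity_eq_integral_toReal_smul (measurable_gaussWeight ν)
    (Filter.Eventually.of_forall fun _ => ENNReal.ofReal_lt_top)]
  refine integral_congr_ae (Filter.Eventually.of_forall fun z => ?_)
  simp only [ENNReal.toReal_ofReal (gaussWeight_pos hν z).le, Complex.real_smul]

theorem integrable_exp_neg_mul_sq_norm {E : Type*} [NormedAddCommGroup E] [InnerProductSpace ℝ E]
    [FiniteDimensional ℝ E] [MeasurableSpace E] [BorelSpace E] {b : ℝ} (hb : 0 < b) :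
    Integrable fun v : E => Real.exp (-b * ‖v‖ ^ 2) := by
  have := (GaussianFourier.integrable_cexp_neg_mul_sq_norm_add (V := E) (b := (b : ℂ))
    (by simpa using hb) 0 0).norm
  refine this.congr (Filter.Eventually.of_forall fun z => ?_)
  simp [Complex.norm_exp, ← Complex.ofReal_pow, Complex.mul_re]

theorem integral_gaussWeight (hν : 0 < ν) : ∫ z, gaussWeight d ν z = 1 := by
  unfold gaussWeight
  rw [integral_const_mul, GaussianFourier.integral_rexp_neg_mul_sq_norm hν]
  -- The real dimension `2d` makes the Gaussian integral `(π/ν)^d`, the inverse of the normalising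
  -- factor.
  have : Module.finrank ℝ (CSp d) = 2 * d := by
    rw [← Module.finrank_mul_finrank ℝ ℂ (CSp d)]; simp
  rw [this, Nat.cast_mul, Nat.cast_ofNat, mul_div_cancel_left₀ _ two_ne_zero, Real.rpow_natCast,
    ← mul_pow, div_mul_div_comm, mul_comm, div_self (by positivity), one_pow]

theorem integrable_gaussWeight (hν : 0 < ν) : Integrable (gaussWeight d ν) :=
  (integrable_exp_neg_mul_sq_norm hν).const_mul _

theorem isProbabilityMeasure_fockMeasure (hν : 0 < ν) :
    IsProbabilityMeasure (fockMeasure d ν) := by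
  refine ⟨?_⟩
  rw [fockMeasure, withDensity_apply _ MeasurableSet.univ, Measure.restrict_univ,
    ← ofReal_integral_eq_lintegral_ofReal (integrable_gaussWeight hν)
      (Filter.Eventually.of_forall fun z => (gaussWeight_pos hν z).le),
    integral_gaussWeight hν, ENNReal.ofReal_one]

theorem measurePreserving_smul_fockMeasure {c : ℂ} (hc : ‖c‖ = 1) :
    MeasurePreserving (fun w : CSp d => c • w) (fockMeasure d ν) (fockMeasure d ν) := by
  refine ⟨by fun_prop, ?_⟩
  have hm := measurePreserving_smul (d := d) hc
  refine Measure.ext fun s hs => ?_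
  rw [Measure.map_apply (by fun_prop) hs, fockMeasure,
    withDensity_apply _ ((measurable_const_smul c) hs), withDensity_apply _ hs,
    ← hm.setLIntegral_comp_preimage hs (measurable_gaussWeight ν)]
  simp [gaussWeight, norm_smul, hc]

/-- The mean value property of entire functions with respect to the Gaussian measure. -/
theorem integral_fockMeasure_eq_apply_zero (hν : 0 < ν) {h : CSp d → ℂ} (hh : Differentiable ℂ h)
    (hi : Integrable h (fockMeasure d ν)) : ∫ w, h w ∂fockMeasure d ν = h 0 := by
  have := isProbabilityMeasure_fockMeasure (d := d) hν
  have hn : ∀ θ, ‖circleMap 0 1 θ‖ = 1 := fun θ => by simp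
  have hci : ∀ θ, ∫ w, h (circleMap 0 1 θ • w) ∂fockMeasure d ν = ∫ w, h w ∂fockMeasure d ν :=
    fun θ => (measurePreserving_smul_fockMeasure (hn θ)).integral_comp
      (Homeomorph.smulOfNeZero (circleMap 0 1 θ)
        (by simp)).measurableEmbedding _
  have hcont : Continuous fun q : CSp d × ℝ => h (circleMap 0 1 q.2 • q.1) :=
    hh.continuous.comp (((continuous_circleMap 0 1).comp continuous_snd).smul continuous_fst)
  -- Every rotation of `h` has the same `L¹` norm and the range of angles has finite length, which
  -- gives integrability on the product.
  have hprod : Integrable (Function.uncurry fun (w : CSp d) (θ : ℝ) => h (circleMap 0 1 θ • w))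
      ((fockMeasure d ν).prod (volume.restrict (Set.Ioc 0 (2 * Real.pi)))) := by
    refine (integrable_prod_iff' hcont.aestronglyMeasurable).2 ⟨?_, ?_⟩
    · refine Filter.Eventually.of_forall fun θ => ?_
      exact (measurePreserving_smul_fockMeasure (hn θ)).integrable_comp_of_integrable hi
    · have : ∀ θ, ∫ w, ‖h (circleMap 0 1 θ • w)‖ ∂fockMeasure d ν =
          ∫ w, ‖h w‖ ∂fockMeasure d ν :=
        fun θ => (measurePreserving_smul_fockMeasure (hn θ)).integral_comp
          (Homeomorph.smulOfNeZero (circleMap 0 1 θ)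
            (by simp)).measurableEmbedding
              (fun w => ‖h w‖)
      simp only [this]
      exact integrable_const _
  -- The one-variable mean value property of `ζ ↦ h(ζ w)` on the unit circle.
  have hmv : ∀ w, (2 * Real.pi : ℂ)⁻¹ * ∫ θ in Set.Ioc 0 (2 * Real.pi),
      h (circleMap 0 1 θ • w) = h 0 := by
    intro w
    have hk : Differentiable ℂ fun ζ : ℂ => h (ζ • w) := hh.comp (by fun_prop)
    have h1 : Real.circleAverage (fun ζ : ℂ => h (ζ • w)) 0 1 = h ((0 : ℂ) • w) :=
      hk.diffContOnCl.circleAverage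
    rw [zero_smul, Real.circleAverage_def, intervalIntegral.integral_of_le (by positivity),
      Complex.real_smul] at h1
    simpa using h1
  -- The double integral is evaluated twice: swapped, rotation invariance gives `2π ∫ h`; unswapped,
  -- the mean value property gives `2π h(0)`.
  have h1 : ∫ w, (∫ θ in Set.Ioc 0 (2 * Real.pi), h (circleMap 0 1 θ • w)) ∂fockMeasure d ν =
      (2 * Real.pi : ℂ) * ∫ w, h w ∂fockMeasure d ν := by
    rw [integral_integral_swap hprod]
    simp only [hci]
    rw [setIntegral_const]
    simp [measureReal_def, Real.pi_pos.le]
  have h2 : ∫ w, (2 * Real.pi : ℂ)⁻¹ *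
      (∫ θ in Set.Ioc 0 (2 * Real.pi), h (circleMap 0 1 θ • w)) ∂fockMeasure d ν = h 0 := by
    simp only [hmv]
    simp
  rw [integral_const_mul, h1, inv_mul_cancel_left₀ (by simp [Real.pi_ne_zero])] at h2
  exact h2

/-- The exponential function `w ↦ exp(ν ⟨z, w⟩)`, the reproducing kernel at `z`. -/
noncomputable def fockKernelFun (ν : ℝ) (z w : CSp d) : ℂ := Complex.exp (ν * inner ℂ z w)

theorem differentiable_fockKernelFun (ν : ℝ) (z : CSp d) :
    Differentiable ℂ (fockKernelFun ν z) := by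
  have h1 : Differentiable ℂ fun w : CSp d => (inner ℂ z w : ℂ) :=
    (innerSL ℂ z).differentiable
  exact (h1.const_mul _).cexp

theorem norm_fockKernelFun (ν : ℝ) (z w : CSp d) :
    ‖fockKernelFun ν z w‖ = Real.exp (ν * RCLike.re (inner ℂ z w : ℂ)) := by
  simp [fockKernelFun, Complex.norm_exp]

/-- Completing the square, `|exp(ν⟨z, w⟩)|² exp(-ν‖w‖²) = exp(ν‖z‖²) exp(-ν‖w - z‖²)`, a translated
Gaussian. -/
theorem memLp_fockKernelFun (hν : 0 < ν) (z : CSp d) :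
    MemLp (fockKernelFun ν z) 2 (fockMeasure d ν) := by
  have hc := (differentiable_fockKernelFun ν z).continuous
  rw [memLp_two_iff_integrable_sq_norm hc.aestronglyMeasurable, fockMeasure,
    integrable_withDensity_iff_integrable_smul' (measurable_gaussWeight ν)
      (Filter.Eventually.of_forall fun z => ENNReal.ofReal_lt_top)]
  refine ((integrable_gaussWeight (d := d) hν).comp_sub_right z |>.const_mul
    (Real.exp (ν * ‖z‖ ^ 2))).congr (Filter.Eventually.of_forall fun w => ?_)
  simp only
  rw [ENNReal.toReal_ofReal (gaussWeight_pos hν w).le, norm_fockKernelFun, ← Real.exp_nat_mul,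
    smul_eq_mul, gaussWeight, gaussWeight, mul_assoc, mul_left_comm, ← Real.exp_add, ← Real.exp_add,
    norm_sub_sq (𝕜 := ℂ), inner_re_symm (𝕜 := ℂ) w z]
  congr 2
  push_cast; ring

/-- The reproducing kernel of the Fock space. -/
noncomputable def fockKernel (hν : 0 < ν) (z : CSp d) : fockSpace d ν :=
  ⟨(memLp_fockKernelFun hν z).toLp _, fockKernelFun ν z, differentiable_fockKernelFun ν z,
    (memLp_fockKernelFun hν z).coeFn_toLp⟩

theorem fockRep_fockKernel (hν : 0 < ν) (z : CSp d) :
    fockRep (fockKernel hν z) = fockKernelFun ν z :=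
  fockRep_eq hν (differentiable_fockKernelFun ν z) (memLp_fockKernelFun hν z).coeFn_toLp

theorem fockRep_fockPoly (hν : 0 < ν) (p : MvPolynomial (Fin d) ℂ) :
    fockRep (fockPoly hν p) = fun z => MvPolynomial.eval z.ofLp p :=
  fockRep_eq hν (differentiable_eval p) (memLp_eval hν p).coeFn_toLp

theorem inner_fockSpace (f g : fockSpace d ν) :
    inner ℂ f g = ∫ w, inner ℂ (fockRep f w) (fockRep g w) ∂fockMeasure d ν := by
  rw [Submodule.coe_inner, L2.inner_def]
  refine integral_congr_ae ?_
  filter_upwards [fockRep_ae f, fockRep_ae g] with w h1 h2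
  rw [h1, h2]

/-- The reproducing property. -/
theorem inner_fockKernel (hν : 0 < ν) (z : CSp d) (f : fockSpace d ν) :
    inner ℂ (fockKernel hν z) f = fockRep f z := by
  -- Substituting `w = z + u` recentres the Gaussian at `0`: `-⟨z+u, z+u⟩ + ⟨z+u, z⟩ = -⟨u, u⟩ - ⟨z,
  -- u⟩`. What remains is entire in `u` with value `f(z)` at `u = 0`, so the Gaussian mean value
  -- property applies.
  have key : ∀ u, (gaussWeight d ν (z + u) : ℂ) *
      inner ℂ (fockKernelFun ν z (z + u)) (fockRep f (z + u)) =
      (gaussWeight d ν u : ℂ) * (fockRep f (z + u) * Complex.exp (-ν * inner ℂ z u)) := by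
    intro u
    have e1 : inner ℂ (fockKernelFun ν z (z + u)) (fockRep f (z + u)) =
        fockRep f (z + u) * Complex.exp (ν * inner ℂ (z + u) z) := by
      rw [RCLike.inner_apply]
      congr 1
      rw [fockKernelFun, ← Complex.exp_conj, map_mul, Complex.conj_ofReal, inner_conj_symm]
    have e2 : ((‖z + u‖ ^ 2 : ℝ) : ℂ) = inner ℂ (z + u) (z + u) := by
      rw [inner_self_eq_norm_sq_to_K]; simp
    have e3 : ((‖u‖ ^ 2 : ℝ) : ℂ) = inner ℂ u u := by
      rw [inner_self_eq_norm_sq_to_K]; simp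
    rw [e1, gaussWeight, gaussWeight, Complex.ofReal_mul, Complex.ofReal_mul, Complex.ofReal_exp,
      Complex.ofReal_exp, Complex.ofReal_mul, Complex.ofReal_mul, e2, e3]
    have e4 : Complex.exp (((-ν : ℝ) : ℂ) * inner ℂ (z + u) (z + u)) *
        Complex.exp (ν * inner ℂ (z + u) z) =
        Complex.exp (((-ν : ℝ) : ℂ) * inner ℂ u u) * Complex.exp (-ν * inner ℂ z u) := by
      rw [← Complex.exp_add, ← Complex.exp_add]
      congr 1
      simp only [inner_add_left, inner_add_right]
      push_cast; ring
    linear_combination ((((ν / Real.pi) ^ d : ℝ) : ℂ) * fockRep f (z + u)) * e4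
  have hh : Differentiable ℂ fun u => fockRep f (z + u) * Complex.exp (-ν * inner ℂ z u) := by
    have h1 : Differentiable ℂ fun w : CSp d => (inner ℂ z w : ℂ) :=
      (innerSL ℂ z).differentiable
    exact ((fockRep_differentiable f).comp (by fun_prop)).mul ((h1.const_mul _).cexp)
  have hint : Integrable (fun w => inner ℂ (fockKernelFun ν z w) (fockRep f w))
      (fockMeasure d ν) := by
    have h1 := L2.integrable_inner (𝕜 := ℂ) (fockKernel hν z : Lp ℂ 2 (fockMeasure d ν))
      (f : Lp ℂ 2 (fockMeasure d ν))
    refine h1.congr ?_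
    filter_upwards [fockRep_ae (fockKernel hν z), fockRep_ae f] with w h1 h2
    rw [h1, h2, fockRep_fockKernel]
  -- Integrability is that of a product of two `L²` functions, carried over by the translation.
  have hint2 : Integrable (fun u => fockRep f (z + u) * Complex.exp (-ν * inner ℂ z u))
      (fockMeasure d ν) := by
    rw [fockMeasure, integrable_withDensity_iff_integrable_smul' (measurable_gaussWeight ν)
      (Filter.Eventually.of_forall fun z => ENNReal.ofReal_lt_top)] at hint ⊢
    refine (hint.comp_add_left z).congr (Filter.Eventually.of_forall fun u => ?_)
    simp only [ENNReal.toReal_ofReal (gaussWeight_pos hν _).le, Complex.real_smul]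
    exact key u
  rw [inner_fockSpace, fockRep_fockKernel, integral_fockMeasure hν, ← integral_add_left_eq_self _ z]
  simp only [key]
  rw [← integral_fockMeasure hν, integral_fockMeasure_eq_apply_zero hν hh hint2]
  simp

/-! ### `R R*` as a Gaussian convolution and its square root. -/

theorem inner_incl (x y : RSp d) : (inner ℂ (incl x) (incl y) : ℂ) = (inner ℝ x y : ℝ) := by
  simp [PiLp.inner_apply, incl]

theorem coeFn_restrictOp (hν : 0 < ν) (f : fockSpace d ν) :
    restrictOp hν f =ᵐ[volume] restrictFun ν (fockRep f) :=
  (memLp_restrictFun hν f).coeFn_toLp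

/-- Evaluation at `z` is pairing with the kernel `K_z`, and `⟨K_z, R* g⟩ = ⟨R K_z, g⟩`. -/
theorem fockRep_adjoint_restrictOp [CompleteSpace (fockSpace d ν)] (hν : 0 < ν)
    (g : Lp ℂ 2 (volume : Measure (RSp d))) (z : CSp d) :
    fockRep (ContinuousLinearMap.adjoint (restrictOp hν) g) z =
      ∫ y, Complex.exp (ν * inner ℂ (incl y) z) * (Real.exp (-ν / 2 * ‖y‖ ^ 2) : ℝ) * g y := by
  rw [← inner_fockKernel hν, ContinuousLinearMap.adjoint_inner_right, L2.inner_def]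
  refine integral_congr_ae ?_
  filter_upwards [coeFn_restrictOp hν (fockKernel hν z)] with y hy
  rw [hy, fockRep_fockKernel, restrictFun, RCLike.inner_apply, map_mul, Complex.conj_ofReal,
    fockKernelFun, ← Complex.exp_conj, map_mul, Complex.conj_ofReal, inner_conj_symm]
  ring

/-- The two weights and the kernel combine to a square: `⟨y, x⟩ - ‖x‖²/2 - ‖y‖²/2 = -‖x - y‖²/2`. -/
theorem restrictOp_adjoint_apply [CompleteSpace (fockSpace d ν)] (hν : 0 < ν)
    (g : Lp ℂ 2 (volume : Measure (RSp d))) :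
    restrictOp hν (ContinuousLinearMap.adjoint (restrictOp hν) g) =ᵐ[volume]
      fun x => ∫ y, (Real.exp (-(ν / 2) * ‖x - y‖ ^ 2) : ℂ) * g y := by
  filter_upwards [coeFn_restrictOp hν (ContinuousLinearMap.adjoint (restrictOp hν) g)] with x hx
  rw [hx, restrictFun, fockRep_adjoint_restrictOp, ← integral_mul_const]
  refine integral_congr_ae (Filter.Eventually.of_forall fun y => ?_)
  simp only
  rw [inner_incl, mul_right_comm]
  congr 1
  rw [← Complex.ofReal_mul, ← Complex.ofReal_exp, ← Complex.ofReal_mul, ← Complex.ofReal_mul,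
    ← Real.exp_add, ← Real.exp_add, norm_sub_sq_real, real_inner_comm y x]
  congr 2
  ring

/-- With `z` measured from the midpoint of `x` and `y`, the parallelogram law turns the sum of the
two squared distances into `2‖z‖² + ‖x - y‖²/2`. -/
theorem integral_gaussian_mul_gaussian {b : ℝ} (hb : 0 < b) (x y : RSp d) :
    ∫ z, Real.exp (-b * ‖y - z‖ ^ 2) * Real.exp (-b * ‖x - z‖ ^ 2) =
      (Real.pi / (2 * b)) ^ ((d : ℝ) / 2) * Real.exp (-(b / 2) * ‖x - y‖ ^ 2) := by
  rw [← integral_add_left_eq_self _ ((1 / 2 : ℝ) • (x + y))]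
  have h := GaussianFourier.integral_rexp_neg_mul_sq_norm (V := RSp d) (b := 2 * b) (by positivity)
  rw [finrank_euclideanSpace_fin] at h
  rw [← h, ← integral_mul_const]
  refine integral_congr_ae (Filter.Eventually.of_forall fun z => ?_)
  simp only
  rw [← Real.exp_add, ← Real.exp_add]
  congr 1
  have h1 : y - ((1 / 2 : ℝ) • (x + y) + z) = -((1 / 2 : ℝ) • (x - y) + z) := by module
  have h2 : x - ((1 / 2 : ℝ) • (x + y) + z) = (1 / 2 : ℝ) • (x - y) - z := by module
  rw [h1, h2, norm_neg, norm_add_sq_real, norm_sub_sq_real, norm_smul]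
  norm_num
  ring

theorem memLp_gaussian {b : ℝ} (hb : 0 < b) (x : RSp d) :
    MemLp (fun y => (Real.exp (-b * ‖x - y‖ ^ 2) : ℂ)) 2 (volume : Measure (RSp d)) := by
  rw [memLp_two_iff_integrable_sq_norm (by fun_prop)]
  refine ((integrable_exp_neg_mul_sq_norm (E := RSp d) (b := 2 * b)
    (by positivity)).comp_sub_left x).congr (Filter.Eventually.of_forall fun y => ?_)
  simp only
  rw [Complex.norm_real, Real.norm_of_nonneg (Real.exp_nonneg _),
    ← Real.exp_nat_mul]
  congr 1
  push_cast; ring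

/-- Reading a convolution as an inner product lets self-adjointness of `gaussOp` take the place of
Fubini in `gaussOp_semigroup`. -/
theorem inner_gaussian {b : ℝ} (hb : 0 < b) (x : RSp d) (g : Lp ℂ 2 (volume : Measure (RSp d))) :
    inner ℂ ((memLp_gaussian hb x).toLp _) g = ∫ y, (Real.exp (-b * ‖x - y‖ ^ 2) : ℂ) * g y := by
  rw [L2.inner_def]
  refine integral_congr_ae ?_
  filter_upwards [(memLp_gaussian hb x).coeFn_toLp] with y hy
  rw [hy, RCLike.inner_apply, Complex.conj_ofReal, mul_comm]

/-- Convolution with the Gaussian `exp(-ν‖x‖²/2)` on `L²(V)`, in the form `R R*`. -/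
noncomputable def gaussOp (hν : 0 < ν) :
    Lp ℂ 2 (volume : Measure (RSp d)) →L[ℂ] Lp ℂ 2 (volume : Measure (RSp d)) :=
  have : CompleteSpace (fockSpace d ν) := (isClosed_fockSpace hν).completeSpace_coe
  restrictOp hν ∘L ContinuousLinearMap.adjoint (restrictOp hν)

theorem gaussOp_apply (hν : 0 < ν) (g : Lp ℂ 2 (volume : Measure (RSp d))) :
    gaussOp hν g =ᵐ[volume] fun x => ∫ y, (Real.exp (-(ν / 2) * ‖x - y‖ ^ 2) : ℂ) * g y := by
  have : CompleteSpace (fockSpace d ν) := (isClosed_fockSpace hν).completeSpace_coe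
  exact restrictOp_adjoint_apply hν g

theorem isPositive_gaussOp (hν : 0 < ν) : (gaussOp (d := d) hν).IsPositive := by
  have : CompleteSpace (fockSpace d ν) := (isClosed_fockSpace hν).completeSpace_coe
  exact ContinuousLinearMap.isPositive_self_comp_adjoint _

/-- The kernel `exp(-ν‖x - y‖²)` is that of the candidate square root. Obtaining it as `R R*` for
the parameter `2ν` makes the operator bounded and positive at once. -/
theorem gaussOp_two_mul_apply (h2 : 0 < 2 * ν)
    (g : Lp ℂ 2 (volume : Measure (RSp d))) :
    gaussOp h2 g =ᵐ[volume] fun x => ∫ y, (Real.exp (-ν * ‖x - y‖ ^ 2) : ℂ) * g y := by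
  filter_upwards [gaussOp_apply h2 g] with x hx
  rw [mul_div_cancel_left₀ _ two_ne_zero] at hx
  exact hx

theorem gaussOp_gaussian (hν : 0 < ν) (h2 : 0 < 2 * ν) (x : RSp d) :
    gaussOp h2 ((memLp_gaussian hν x).toLp _) =ᵐ[volume] fun y =>
      (((Real.pi / (2 * ν)) ^ ((d : ℝ) / 2) * Real.exp (-(ν / 2) * ‖x - y‖ ^ 2) : ℝ) : ℂ) := by
  filter_upwards [gaussOp_two_mul_apply h2 ((memLp_gaussian hν x).toLp _)] with y hy
  rw [hy, ← integral_gaussian_mul_gaussian hν, ← integral_complex_ofReal]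
  refine integral_congr_ae ?_
  filter_upwards [(memLp_gaussian hν x).coeFn_toLp] with z hz
  rw [hz, Complex.ofReal_mul]

/-- The semigroup property of the Gaussian convolution operators. -/
theorem gaussOp_semigroup (hν : 0 < ν) (h2 : 0 < 2 * ν)
    (g : Lp ℂ 2 (volume : Measure (RSp d))) : gaussOp h2 (gaussOp h2 g) =
      (((Real.pi / (2 * ν)) ^ ((d : ℝ) / 2) : ℝ) : ℂ) • gaussOp hν g := by
  refine Lp.ext ?_
  filter_upwards [gaussOp_two_mul_apply h2 (gaussOp h2 g),
    Lp.coeFn_smul (((Real.pi / (2 * ν)) ^ ((d : ℝ) / 2) : ℝ) : ℂ) (gaussOp hν g),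
    gaussOp_apply hν g] with x h1 h3 h4
  -- With `γ_x` the Gaussian centred at `x` and `G` the operator `gaussOp h2`, this is `⟨γ_x, G g⟩ =
  -- ⟨G γ_x, g⟩`, and `G γ_x` is known from `gaussOp_gaussian`.
  rw [h1, ← inner_gaussian hν, h3, Pi.smul_apply, h4, smul_eq_mul,
    ← (isPositive_gaussOp h2).inner_left_eq_inner_right, L2.inner_def, ← integral_const_mul]
  refine integral_congr_ae ?_
  filter_upwards [gaussOp_gaussian hν h2 x] with y hy
  rw [hy, RCLike.inner_apply, Complex.conj_ofReal, Complex.ofReal_mul]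
  ring

-- Uniqueness of the positive square root: `c B` is positive and its square is `c² a S S* = S S*`.
open scoped ComplexOrder in
theorem absOp_eq_smul_of_isPositive {X Y : Type*} [NormedAddCommGroup X] [InnerProductSpace ℂ X]
    [CompleteSpace X] [NormedAddCommGroup Y] [InnerProductSpace ℂ Y] [CompleteSpace Y]
    {S : X →L[ℂ] Y} {B : Y →L[ℂ] Y} (hB : B.IsPositive)
    {a c : ℝ} (hc : 0 ≤ c) (hca : c * c * a = 1)
    (h : ∀ y, B (B y) = (a : ℂ) • S (ContinuousLinearMap.adjoint S y)) :
    absOp S = (c : ℂ) • B := by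
  refine CFC.sqrt_unique (ContinuousLinearMap.ext fun y => ?_)
    ((ContinuousLinearMap.nonneg_iff_isPositive _).2
      (hB.smul_of_nonneg (Complex.zero_le_real.2 hc)))
  rw [mul_apply_eq_comp, smul_apply, smul_apply, map_smul, smul_smul, h, smul_smul,
    ← Complex.ofReal_mul, ← Complex.ofReal_mul, hca, Complex.ofReal_one, one_smul,
    ContinuousLinearMap.comp_apply]

theorem absOp_restrictOp [CompleteSpace (fockSpace d ν)] (hν : 0 < ν) (h2 : 0 < 2 * ν) :
    absOp (restrictOp (d := d) hν) =
      (((2 * ν / Real.pi) ^ ((d : ℝ) / 4) : ℝ) : ℂ) • gaussOp h2 := by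
  -- The constant `c` must satisfy `c² (π/(2ν))^(d/2) = 1`, where `(π/(2ν))^(d/2)` is the factor in
  -- the semigroup property.
  have hcc : (2 * ν / Real.pi) ^ ((d : ℝ) / 4) * (2 * ν / Real.pi) ^ ((d : ℝ) / 4) *
      (Real.pi / (2 * ν)) ^ ((d : ℝ) / 2) = 1 := by
    rw [← Real.rpow_add (by positivity), ← add_div, show ((d : ℝ) + d) / 4 = d / 2 by ring,
      ← Real.mul_rpow (by positivity) (by positivity), div_mul_div_comm,
      mul_comm Real.pi, div_self (by positivity), Real.one_rpow]
  exact absOp_eq_smul_of_isPositive (isPositive_gaussOp h2) (by positivity) hcc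
    (gaussOp_semigroup hν h2)

theorem absOp_restrictOp_apply [CompleteSpace (fockSpace d ν)] (hν : 0 < ν)
    (g : Lp ℂ 2 (volume : Measure (RSp d))) : absOp (restrictOp hν) g =ᵐ[volume] fun x =>
      (((2 * ν / Real.pi) ^ ((d : ℝ) / 4) : ℝ) : ℂ) *
        ∫ y, (Real.exp (-ν * ‖x - y‖ ^ 2) : ℂ) * g y := by
  have h2 : 0 < 2 * ν := by positivity
  rw [absOp_restrictOp hν h2, smul_apply]
  filter_upwards [Lp.coeFn_smul (((2 * ν / Real.pi) ^ ((d : ℝ) / 4) : ℝ) : ℂ) (gaussOp h2 g),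
    gaussOp_two_mul_apply h2 g] with x h3 h4
  rw [h3, Pi.smul_apply, h4, smul_eq_mul]

/-! ### Injectivity of `|R|`. -/

open scoped FourierTransform SchwartzMap in
/-- Injectivity of the Fourier transform on integrable functions. -/
theorem ae_eq_zero_of_fourier_eq_zero {h : RSp d → ℂ} (hi : Integrable h)
    (h0 : ∀ w : RSp d, ∫ y, Complex.exp (Complex.I * (inner ℝ y w : ℝ)) * h y = 0) :
    h =ᵐ[volume] 0 := by
  have hF : ∀ w, VectorFourier.fourierIntegral Real.fourierChar volume (innerₗ (RSp d)) h w = 0 := by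
    intro w
    have h1 := Real.fourier_eq' h w
    -- The rescaling by `-2π` passes between `exp(i⟨y, w⟩)` and the kernel `exp(-2πi⟨y, w⟩)` of `𝓕`.
    have h2 := h0 ((-2 * Real.pi) • w)
    change 𝓕 h w = 0
    rw [h1, ← h2]
    refine integral_congr_ae (Filter.Eventually.of_forall fun y => ?_)
    simp only
    rw [smul_eq_mul, inner_smul_right]
    congr 2
    push_cast; ring
  refine ae_eq_zero_of_integral_contDiff_smul_eq_zero hi.locallyIntegrable fun g hg hgc => ?_
  let φ : 𝓢(RSp d, ℂ) :=
    (hgc.comp_left (g := fun t : ℝ => (t : ℂ)) Complex.ofReal_zero).toSchwartzMap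
    (Complex.ofRealCLM.contDiff.comp hg)
  -- A test function is the Fourier transform of the Schwartz function `𝓕⁻ φ`; moving the transform
  -- onto `h` makes its pairing with `h` vanish.
  have h3 := VectorFourier.integral_fourierIntegral_smul_eq_flip (L := innerₗ (RSp d))
    (μ := volume) (ν := volume)
    Real.continuous_fourierChar continuous_inner hi (𝓕⁻ φ).integrable
  have h4 : ∀ x, VectorFourier.fourierIntegral Real.fourierChar volume (innerₗ (RSp d)).flip
      (𝓕⁻ φ : 𝓢(RSp d, ℂ)) x = (g x : ℂ) := by
    intro x
    rw [flip_innerₗ]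
    have h5 : (𝓕 (𝓕⁻ φ) : 𝓢(RSp d, ℂ)) x = φ x := by
      rw [FourierTransform.fourier_fourierInv_eq]
    rw [SchwartzMap.fourier_coe] at h5
    exact h5
  simp only [hF, h4, zero_smul, integral_zero] at h3
  rw [h3]
  refine integral_congr_ae (Filter.Eventually.of_forall fun y => ?_)
  simp only [Complex.real_smul, smul_eq_mul, mul_comm]

/-- Since `‖|R| g‖ = ‖R* g‖`, a null vector `g` has `R* g = 0` on all of `ℂ^d`. The values of `R* g`
at purely imaginary points are the Fourier transform of `exp(-ν‖y‖²/2) g(y)`, hence `g = 0`. -/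
theorem absOp_restrictOp_injective [CompleteSpace (fockSpace d ν)] (hν : 0 < ν) :
    Function.Injective (absOp (restrictOp (d := d) hν)) := by
  rw [injective_iff_map_eq_zero]
  intro g hg
  have h1 : ContinuousLinearMap.adjoint (restrictOp hν) g = 0 := by
    rw [← norm_eq_zero, ← norm_absOp_apply, hg, norm_zero]
  have h2 : ∀ z : CSp d, ∫ y, Complex.exp (ν * inner ℂ (incl y) z) *
      (Real.exp (-ν / 2 * ‖y‖ ^ 2) : ℝ) * g y = 0 := by
    intro z
    rw [← fockRep_adjoint_restrictOp hν, ← inner_fockKernel hν, h1, inner_zero_right]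
  have hi : Integrable fun y : RSp d => (Real.exp (-ν / 2 * ‖y‖ ^ 2) : ℂ) * g y := by
    have h3 := memLp_gaussian (d := d) (half_pos hν) 0
    simp only [zero_sub, norm_neg, ← neg_div] at h3
    exact h3.integrable_mul (Lp.memLp g)
  have h4 := ae_eq_zero_of_fourier_eq_zero hi fun w => by
    -- At `z = (i/ν) w` the exponent `ν⟨y, z⟩` becomes `i⟨y, w⟩`.
    rw [← h2 ((Complex.I / ν) • incl w)]
    refine integral_congr_ae (Filter.Eventually.of_forall fun y => ?_)
    simp only
    rw [inner_smul_right, inner_incl, ← mul_assoc, ← mul_assoc,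
      mul_div_cancel₀ _ (Complex.ofReal_ne_zero.2 hν.ne')]
  refine Lp.ext ?_
  filter_upwards [h4, Lp.coeFn_zero ℂ 2 (volume : Measure (RSp d))] with y hy h0
  rw [h0]
  exact (mul_eq_zero.1 hy).resolve_left (Complex.ofReal_ne_zero.2 (Real.exp_ne_zero _))

/-! ### The Segal-Bargmann transform of a polynomial. -/

theorem continuous_eval_incl (q : MvPolynomial (Fin d) ℂ) :
    Continuous fun y : RSp d => MvPolynomial.eval (incl y).ofLp q :=
  (differentiable_eval q).continuous.comp continuous_incl

theorem integrable_eval_mul_gaussian {b : ℝ} (hb : 0 < b) (q : MvPolynomial (Fin d) ℂ) :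
    Integrable fun y : RSp d =>
      MvPolynomial.eval (incl y).ofLp q * (Real.exp (-b * ‖y‖ ^ 2) : ℂ) := by
  -- Growth rate `b/2` for the polynomial leaves the decay `exp(-b‖y‖²/2)`.
  obtain ⟨C, hC, h⟩ := poly_bound q (b / 2) (by positivity)
  refine ((integrable_exp_neg_mul_sq_norm (E := RSp d) (b := b / 2)
    (by positivity)).const_mul C).mono' ?_ (Filter.Eventually.of_forall fun y => ?_)
  · exact ((continuous_eval_incl q).mul (by fun_prop)).aestronglyMeasurable
  · rw [norm_mul, Complex.norm_real, Real.norm_of_nonneg (Real.exp_nonneg _)]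
    calc _ ≤ C * Real.exp (b / 2 * ‖incl y‖ ^ 2) * Real.exp (-b * ‖y‖ ^ 2) := by gcongr; exact h _
      _ = _ := by
        rw [norm_incl, mul_assoc, ← Real.exp_add]
        congr 2; ring

theorem memLp_eval_mul_gaussian {b : ℝ} (hb : 0 < b) (q : MvPolynomial (Fin d) ℂ) :
    MemLp (fun y : RSp d => MvPolynomial.eval (incl y).ofLp q * (Real.exp (-b * ‖y‖ ^ 2) : ℂ)) 2
      volume := by
  have hc : Continuous fun y : RSp d =>
      MvPolynomial.eval (incl y).ofLp q * (Real.exp (-b * ‖y‖ ^ 2) : ℂ) :=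
    (continuous_eval_incl q).mul (by fun_prop)
  rw [memLp_two_iff_integrable_sq_norm hc.aestronglyMeasurable]
  -- The squared norm is the norm of `q²` times a Gaussian of rate `2b`, which reduces `L²` to `L¹`.
  refine (integrable_eval_mul_gaussian (b := 2 * b) (by positivity) (q * q)).norm.congr
    (Filter.Eventually.of_forall fun y => ?_)
  simp only
  rw [map_mul, norm_mul, norm_mul, norm_mul, mul_pow, Complex.norm_real, Complex.norm_real,
    Real.norm_of_nonneg (Real.exp_nonneg _), Real.norm_of_nonneg (Real.exp_nonneg _),
    ← Real.exp_nat_mul, ← sq]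
  congr 2
  push_cast; ring

/-- Links the formal derivative to differentiation along `V`, for the integration by parts in
`gaussianAverage_X_mul`. -/
theorem hasLineDerivAt_eval_incl (q : MvPolynomial (Fin d) ℂ) (j : Fin d) (y : RSp d) :
    HasLineDerivAt ℝ (fun y : RSp d => MvPolynomial.eval (incl y).ofLp q)
      (MvPolynomial.eval (incl y).ofLp (MvPolynomial.pderiv j q)) y (EuclideanSpace.single j 1) := by
  induction q using MvPolynomial.induction_on with
  | C c => simpa [HasLineDerivAt] using hasDerivAt_const (0 : ℝ) c
  | add p q hp hq =>
    simp only [map_add]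
    exact HasDerivAt.add hp hq
  | mul_X p i hp =>
    have hX : HasLineDerivAt ℝ (fun y : RSp d => (incl y).ofLp i)
        ((Pi.single i 1 : Fin d → ℂ) j) y (EuclideanSpace.single j 1) := by
      have h1 : HasDerivAt (fun t : ℝ => ((y i + t * (Pi.single j 1 : Fin d → ℝ) i : ℝ) : ℂ))
          (((Pi.single j 1 : Fin d → ℝ) i : ℝ) : ℂ) 0 :=
        HasDerivAt.ofReal_comp (by
          simpa using ((hasDerivAt_id (0 : ℝ)).mul_const ((Pi.single j 1 : Fin d → ℝ) i)).const_add
            (y i))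
      have h2 : (((Pi.single j 1 : Fin d → ℝ) i : ℝ) : ℂ) = (Pi.single i 1 : Fin d → ℂ) j := by
        rcases eq_or_ne i j with rfl | h
        · simp
        · simp [h, h.symm]
      rw [h2] at h1
      exact h1
    have h3 := HasDerivAt.mul (𝕜 := ℝ) hp hX
    simp only [zero_smul, add_zero] at h3
    have h4 : MvPolynomial.eval (incl y).ofLp (MvPolynomial.pderiv j (p * MvPolynomial.X i)) =
        MvPolynomial.eval (incl y).ofLp (MvPolynomial.pderiv j p) * (incl y).ofLp i +
          MvPolynomial.eval (incl y).ofLp p * (Pi.single i 1 : Fin d → ℂ) j := by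
      rw [MvPolynomial.pderiv_mul, MvPolynomial.pderiv_X]
      simp only [map_add, map_mul, MvPolynomial.eval_X]
      congr 2
      rcases eq_or_ne i j with rfl | h
      · simp
      · simp [h, h.symm]
    rw [h4]
    simp only [map_mul, MvPolynomial.eval_X]
    exact h3

/-- The convolution of `q(y) exp(-ν‖y‖²)` with the Gaussian `exp(-ν‖y‖²)`. -/
noncomputable def gaussianAverage (ν : ℝ) (q : MvPolynomial (Fin d) ℂ) (x : RSp d) : ℂ :=
  ∫ y, (Real.exp (-ν * ‖x - y‖ ^ 2) : ℂ) *
    (MvPolynomial.eval (incl y).ofLp q * (Real.exp (-ν * ‖y‖ ^ 2) : ℂ))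

theorem integrable_gaussianAverage (hν : 0 < ν) (q : MvPolynomial (Fin d) ℂ) (x : RSp d) :
    Integrable fun y => (Real.exp (-ν * ‖x - y‖ ^ 2) : ℂ) *
      (MvPolynomial.eval (incl y).ofLp q * (Real.exp (-ν * ‖y‖ ^ 2) : ℂ)) := by
  refine (integrable_eval_mul_gaussian hν q).bdd_mul (c := 1) (by fun_prop)
    (Filter.Eventually.of_forall fun y => ?_)
  rw [Complex.norm_real, Real.norm_of_nonneg (Real.exp_nonneg _), Real.exp_le_one_iff]
  have : 0 ≤ ν * ‖x - y‖ ^ 2 := by positivity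
  linarith

theorem gaussianAverage_add (hν : 0 < ν) (p q : MvPolynomial (Fin d) ℂ) (x : RSp d) :
    gaussianAverage ν (p + q) x = gaussianAverage ν p x + gaussianAverage ν q x := by
  unfold gaussianAverage
  rw [← integral_add (integrable_gaussianAverage hν p x) (integrable_gaussianAverage hν q x)]
  simp only [map_add, add_mul, mul_add]

theorem gaussianAverage_C_mul (c : ℂ) (q : MvPolynomial (Fin d) ℂ) (x : RSp d) :
    gaussianAverage ν (MvPolynomial.C c * q) x = c * gaussianAverage ν q x := by
  unfold gaussianAverage
  rw [← integral_const_mul]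
  refine integral_congr_ae (Filter.Eventually.of_forall fun y => ?_)
  simp only [map_mul, MvPolynomial.eval_C]
  ring

theorem gaussianAverage_one (hν : 0 < ν) (x : RSp d) :
    gaussianAverage ν 1 x = (((Real.pi / (2 * ν)) ^ ((d : ℝ) / 2) : ℝ) : ℂ) *
      (Real.exp (-(ν / 2) * ‖x‖ ^ 2) : ℂ) := by
  have h := integral_gaussian_mul_gaussian hν 0 x
  simp only [zero_sub, norm_neg] at h
  rw [← Complex.ofReal_mul, ← h, ← integral_complex_ofReal]
  simp [gaussianAverage]

/-- Integration by parts. With `W(y) = exp(-ν‖x-y‖² - ν‖y‖²)` one has `∂_j W = (2ν x_j - 4ν y_j) W`.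
The integral of `∂_j (q W)` vanishes, and solving for the term with `x_j` shows that multiplication
by `x_j` preserves the set of Gaussian averages of polynomials. -/
theorem gaussianAverage_X_mul (hν : 0 < ν) (j : Fin d) (q : MvPolynomial (Fin d) ℂ) (x : RSp d) :
    (x j : ℂ) * gaussianAverage ν q x = gaussianAverage ν (MvPolynomial.C 2 *
      (MvPolynomial.X j * q + MvPolynomial.C (-(4 * ν : ℂ)⁻¹) * MvPolynomial.pderiv j q)) x := by
  let W : RSp d → ℂ := fun y => (Real.exp (-ν * ‖x - y‖ ^ 2) : ℂ) * (Real.exp (-ν * ‖y‖ ^ 2) : ℂ)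
  have hW : ∀ y, HasLineDerivAt ℝ W (((2 * ν * x j - 4 * ν * y j : ℝ) : ℂ) * W y) y
      (EuclideanSpace.single j 1) := by
    intro y
    have h0 : HasDerivAt (fun t : ℝ => y + t • (EuclideanSpace.single j 1 : RSp d))
        (EuclideanSpace.single j 1) 0 := by
      simpa using ((hasDerivAt_id (0 : ℝ)).smul_const (EuclideanSpace.single j 1 : RSp d)).const_add y
    have h1 := (h0.const_sub x).norm_sq.const_mul (-ν) |>.exp.ofReal_comp
    have h2 := h0.norm_sq.const_mul (-ν) |>.exp.ofReal_comp
    have h3 := h1.mul h2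
    simp only [zero_smul, add_zero] at h3
    refine h3.congr_deriv ?_
    simp only [inner_neg_right, EuclideanSpace.inner_single_right, W]
    simp
    ring
  let Q : MvPolynomial (Fin d) ℂ := MvPolynomial.pderiv j q +
    MvPolynomial.C (2 * ν * x j : ℂ) * q + MvPolynomial.C (-4 * ν : ℂ) * (MvPolynomial.X j * q)
  have hd : ∀ y, HasLineDerivAt ℝ (fun y => MvPolynomial.eval (incl y).ofLp q * W y)
      ((Real.exp (-ν * ‖x - y‖ ^ 2) : ℂ) *
        (MvPolynomial.eval (incl y).ofLp Q * (Real.exp (-ν * ‖y‖ ^ 2) : ℂ))) y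
      (EuclideanSpace.single j 1) := by
    intro y
    have h1 := HasDerivAt.mul (𝕜 := ℝ) (hasLineDerivAt_eval_incl q j y) (hW y)
    simp only [zero_smul, add_zero] at h1
    refine HasDerivAt.congr_deriv h1 ?_
    simp only [map_add, map_mul, MvPolynomial.eval_C, MvPolynomial.eval_X, W, Q]
    have : (incl y).ofLp j = (y j : ℂ) := rfl
    rw [this]
    push_cast
    ring
  have hi : Integrable fun y => MvPolynomial.eval (incl y).ofLp q * W y := by
    refine (integrable_gaussianAverage hν q x).congr (Filter.Eventually.of_forall fun y => ?_)
    simp only [W]; ring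
  -- Integration by parts against the constant function `1`: a derivative integrates to zero.
  have hz := integral_bilinear_hasLineDerivAt_right_eq_neg_left_of_integrable
    (μ := (volume : Measure (RSp d))) (f := fun _ => (1 : ℂ)) (f' := fun _ => 0)
    (v := EuclideanSpace.single j 1)
    (B := ContinuousLinearMap.mul ℝ ℂ) (by simp)
    (by simpa only [ContinuousLinearMap.mul_apply', one_mul] using
      integrable_gaussianAverage hν Q x)
    (by simpa only [ContinuousLinearMap.mul_apply', one_mul] using hi)
    (fun y _ => hasDerivAt_const _ _) (fun y _ => hd y)
  simp only [ContinuousLinearMap.mul_apply', one_mul, zero_mul, integral_zero, neg_zero] at hz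
  change gaussianAverage ν Q x = 0 at hz
  rw [gaussianAverage_add hν, gaussianAverage_add hν, gaussianAverage_C_mul,
    gaussianAverage_C_mul] at hz
  rw [gaussianAverage_C_mul, gaussianAverage_add hν, gaussianAverage_C_mul]
  have : (ν : ℂ) ≠ 0 := Complex.ofReal_ne_zero.2 hν.ne'
  field_simp
  linear_combination 2 * hz

/-- Every polynomial multiple of `exp(-ν‖x‖²/2)` is a Gaussian average. -/
theorem exists_gaussianAverage_eq (hν : 0 < ν) (p : MvPolynomial (Fin d) ℂ) :
    ∃ q, ∀ x, gaussianAverage ν q x =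
      MvPolynomial.eval (incl x).ofLp p * (Real.exp (-(ν / 2) * ‖x‖ ^ 2) : ℂ) := by
  induction p using MvPolynomial.induction_on with
  | C c =>
    have : ((Real.pi / (2 * ν)) ^ ((d : ℝ) / 2)) ≠ 0 := by positivity
    refine ⟨MvPolynomial.C (c / ((Real.pi / (2 * ν)) ^ ((d : ℝ) / 2) : ℝ)) * 1, fun x => ?_⟩
    rw [gaussianAverage_C_mul, gaussianAverage_one hν, ← mul_assoc,
      div_mul_cancel₀ _ (Complex.ofReal_ne_zero.2 this), MvPolynomial.eval_C]
  | add p₁ p₂ h₁ h₂ =>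
    obtain ⟨q₁, h₁⟩ := h₁
    obtain ⟨q₂, h₂⟩ := h₂
    refine ⟨q₁ + q₂, fun x => ?_⟩
    rw [gaussianAverage_add hν, h₁, h₂, map_add, add_mul]
  | mul_X p j h =>
    obtain ⟨q, h⟩ := h
    -- The witness is the polynomial on the right side of `gaussianAverage_X_mul`.
    refine ⟨_, fun x => (gaussianAverage_X_mul hν j q x).symm.trans ?_⟩
    rw [h, map_mul, MvPolynomial.eval_X, mul_right_comm, mul_comm]
    rfl

/-- The Segal-Bargmann transform of a polynomial is a polynomial multiple of a Gaussian. -/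
theorem exists_segalBargmann_fockPoly_eq (hν : 0 < ν) (p : MvPolynomial (Fin d) ℂ) :
    ∃ q : MvPolynomial (Fin d) ℂ,
      segalBargmann hν (fockPoly hν p) =ᵐ[volume]
        (fun y => MvPolynomial.eval (incl y).ofLp q * (Real.exp (-ν * ‖y‖ ^ 2) : ℂ)) ∧
      ∀ x, (((2 * ν / Real.pi) ^ ((d : ℝ) / 4) : ℝ) : ℂ) * gaussianAverage ν q x =
        MvPolynomial.eval (incl x).ofLp p * (Real.exp (-(ν / 2) * ‖x‖ ^ 2) : ℂ) := by
  have : CompleteSpace (fockSpace d ν) := (isClosed_fockSpace hν).completeSpace_coe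
  -- The scalar in `|R|` is divided out of `p` beforehand.
  obtain ⟨q, hq⟩ := exists_gaussianAverage_eq hν
    (MvPolynomial.C ((((2 * ν / Real.pi) ^ ((d : ℝ) / 4) : ℝ) : ℂ)⁻¹) * p)
  have hc : ((2 * ν / Real.pi) ^ ((d : ℝ) / 4)) ≠ 0 := by positivity
  have hq' : ∀ x, (((2 * ν / Real.pi) ^ ((d : ℝ) / 4) : ℝ) : ℂ) * gaussianAverage ν q x =
        MvPolynomial.eval (incl x).ofLp p * (Real.exp (-(ν / 2) * ‖x‖ ^ 2) : ℂ) := by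
    intro x
    rw [hq, map_mul, MvPolynomial.eval_C, mul_assoc,
      mul_inv_cancel_left₀ (Complex.ofReal_ne_zero.2 hc)]
  refine ⟨q, ?_, hq'⟩
  have hm := memLp_eval_mul_gaussian hν q
  -- `U p` and `q(y) exp(-ν‖y‖²)` have the same image `R p` under the injective operator `|R|`.
  have h1 : absOp (restrictOp hν) (segalBargmann hν (fockPoly hν p)) =
      restrictOp hν (fockPoly hν p) :=
    (isPolarPart_polarPart (restrictOp hν)).absOp_apply _
  have h2 : absOp (restrictOp hν) (hm.toLp _) = restrictOp hν (fockPoly hν p) := by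
    refine Lp.ext ?_
    filter_upwards [absOp_restrictOp_apply hν (hm.toLp _),
      coeFn_restrictOp hν (fockPoly hν p)] with x h3 h4
    rw [h3, h4, restrictFun, fockRep_fockPoly, neg_div, ← hq', gaussianAverage]
    congr 1
    refine integral_congr_ae ?_
    filter_upwards [hm.coeFn_toLp] with y hy
    rw [hy]
  rw [absOp_restrictOp_injective hν (h1.trans h2.symm)]
  exact hm.coeFn_toLp

/-! ### The Fourier transform of `U p`. -/

theorem integral_gaussian_fourier {b : ℝ} (hb : 0 < b) (l : RSp d) :
    ∫ u : RSp d, (Real.exp (-b * ‖u‖ ^ 2) : ℂ) * Complex.exp (Complex.I * (inner ℝ l u : ℝ)) =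
      (((Real.pi / b) ^ ((d : ℝ) / 2) * Real.exp (-‖l‖ ^ 2 / (4 * b)) : ℝ) : ℂ) := by
  have h := GaussianFourier.integral_cexp_neg_mul_sq_norm_add (V := RSp d) (b := (b : ℂ))
    (by simpa using hb) Complex.I l
  rw [finrank_euclideanSpace_fin] at h
  have h1 : ((((Real.pi / b) ^ ((d : ℝ) / 2) * Real.exp (-‖l‖ ^ 2 / (4 * b)) : ℝ)) : ℂ) =
      (Real.pi / b : ℂ) ^ ((d : ℂ) / 2) *
        Complex.exp (Complex.I ^ 2 * (‖l‖ : ℂ) ^ 2 / (4 * (b : ℂ))) := by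
    rw [Complex.ofReal_mul, Complex.ofReal_cpow (by positivity), Complex.ofReal_exp, Complex.I_sq]
    push_cast
    congr 2
    ring
  rw [h1, ← h]
  refine integral_congr_ae (Filter.Eventually.of_forall fun u => ?_)
  simp only
  rw [Complex.ofReal_exp, ← Complex.exp_add]
  push_cast
  rfl

theorem norm_exp_I_mul_ofReal (t : ℝ) : ‖Complex.exp (Complex.I * t)‖ = 1 := by
  rw [mul_comm, Complex.norm_exp_ofReal_mul_I]

theorem integrable_mul_exp_I {f : RSp d → ℂ} (hf : Integrable f) (l : RSp d) :
    Integrable fun y => f y * Complex.exp (Complex.I * (inner ℝ l y : ℝ)) :=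
  hf.mul_bdd (c := 1) (by fun_prop)
    (Filter.Eventually.of_forall fun y => (norm_exp_I_mul_ofReal _).le)

/-- The Fourier transform of a Gaussian average. -/
theorem integral_gaussianAverage_mul_exp (hν : 0 < ν) (q : MvPolynomial (Fin d) ℂ) (l : RSp d) :
    ∫ x, gaussianAverage ν q x * Complex.exp (Complex.I * (inner ℝ l x : ℝ)) =
      (∫ y, (MvPolynomial.eval (incl y).ofLp q * (Real.exp (-ν * ‖y‖ ^ 2) : ℂ)) *
        Complex.exp (Complex.I * (inner ℝ l y : ℝ))) *
      (((Real.pi / ν) ^ ((d : ℝ) / 2) * Real.exp (-‖l‖ ^ 2 / (4 * ν)) : ℝ) : ℂ) := by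
  have h1 := integrable_mul_exp_I (integrable_eval_mul_gaussian hν q) l
  have h2 : Integrable fun u : RSp d =>
      (Real.exp (-ν * ‖u‖ ^ 2) : ℂ) * Complex.exp (Complex.I * (inner ℝ l u : ℝ)) :=
    integrable_mul_exp_I (integrable_exp_neg_mul_sq_norm hν).ofReal l
  rw [← integral_gaussian_fourier hν]
  -- As `exp(i⟨l, x⟩) = exp(i⟨l, y⟩) exp(i⟨l, x-y⟩)`, the integrand is a convolution of two
  -- modulated functions, whose integral is the product of their integrals.
  refine Eq.trans ?_ (integral_convolution (ContinuousLinearMap.mul ℝ ℂ) h1 h2)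
  refine integral_congr_ae (Filter.Eventually.of_forall fun x => ?_)
  simp only [convolution, gaussianAverage, ContinuousLinearMap.mul_apply']
  rw [← integral_mul_const]
  refine integral_congr_ae (Filter.Eventually.of_forall fun y => ?_)
  have h3 : Complex.exp (Complex.I * (inner ℝ l x : ℝ)) =
      Complex.exp (Complex.I * (inner ℝ l y : ℝ)) *
        Complex.exp (Complex.I * (inner ℝ l (x - y) : ℝ)) := by
    rw [← Complex.exp_add, inner_sub_right]
    congr 1
    push_cast; ring
  simp only
  rw [h3]
  ring

theorem integrable_segalBargmann_fockPoly (hν : 0 < ν) (p : MvPolynomial (Fin d) ℂ) :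
    Integrable (segalBargmann hν (fockPoly hν p)) := by
  obtain ⟨q, hq, -⟩ := exists_segalBargmann_fockPoly_eq hν p
  exact (integrable_eval_mul_gaussian hν q).congr hq.symm

/-- The Fourier transform of the Segal-Bargmann transform of a polynomial. -/
theorem fourier_segalBargmann_fockPoly (hν : 0 < ν) (p : MvPolynomial (Fin d) ℂ) (l : RSp d) :
    ∫ x, segalBargmann hν (fockPoly hν p) x * Complex.exp (Complex.I * (inner ℝ l x : ℝ)) =
      (((2 * Real.pi / ν) ^ (-(d : ℝ) / 4) * Real.exp (‖l‖ ^ 2 / (4 * ν)) : ℝ) : ℂ) *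
        ∫ x, (MvPolynomial.eval (incl x).ofLp p * (Real.exp (-(ν / 2) * ‖x‖ ^ 2) : ℂ)) *
          Complex.exp (Complex.I * (inner ℝ l x : ℝ)) := by
  obtain ⟨q, hq, hqp⟩ := exists_segalBargmann_fockPoly_eq hν p
  have h1 : ∫ x, segalBargmann hν (fockPoly hν p) x *
      Complex.exp (Complex.I * (inner ℝ l x : ℝ)) =
      ∫ y, (MvPolynomial.eval (incl y).ofLp q * (Real.exp (-ν * ‖y‖ ^ 2) : ℂ)) *
        Complex.exp (Complex.I * (inner ℝ l y : ℝ)) := by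
    refine integral_congr_ae ?_
    filter_upwards [hq] with y hy
    rw [hy]
  rw [h1]
  simp only [← hqp, mul_assoc (((2 * ν / Real.pi) ^ ((d : ℝ) / 4) : ℝ) : ℂ)]
  rw [integral_const_mul, integral_gaussianAverage_mul_exp hν]
  have h2 : (2 * Real.pi / ν) ^ (-(d : ℝ) / 4) * Real.exp (‖l‖ ^ 2 / (4 * ν)) *
      ((2 * ν / Real.pi) ^ ((d : ℝ) / 4) * ((Real.pi / ν) ^ ((d : ℝ) / 2) *
        Real.exp (-‖l‖ ^ 2 / (4 * ν)))) = 1 := by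
    have e1 : Real.exp (‖l‖ ^ 2 / (4 * ν)) * Real.exp (-‖l‖ ^ 2 / (4 * ν)) = 1 := by
      rw [← Real.exp_add, neg_div, add_neg_cancel, Real.exp_zero]
    have e2 : (Real.pi / ν) ^ ((d : ℝ) / 2) =
        (Real.pi / ν) ^ ((d : ℝ) / 4) * (Real.pi / ν) ^ ((d : ℝ) / 4) := by
      rw [← Real.rpow_add (by positivity)]
      congr 1; ring
    -- The scalar in `|R|` times the mass of the Gaussian; this is inverse to the power of `2π/ν` in
    -- the statement.
    have e3 : (2 * ν / Real.pi) ^ ((d : ℝ) / 4) * (Real.pi / ν) ^ ((d : ℝ) / 2) =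
        (2 * Real.pi / ν) ^ ((d : ℝ) / 4) := by
      rw [e2, ← mul_assoc, ← Real.mul_rpow (by positivity) (by positivity),
        ← Real.mul_rpow (by positivity) (by positivity)]
      congr 1
      have := Real.pi_ne_zero
      field_simp
    have e4 : (2 * Real.pi / ν) ^ (-(d : ℝ) / 4) * (2 * Real.pi / ν) ^ ((d : ℝ) / 4) = 1 := by
      rw [← Real.rpow_add (by positivity), neg_div, neg_add_cancel, Real.rpow_zero]
    calc _ = (2 * Real.pi / ν) ^ (-(d : ℝ) / 4) *
          ((2 * ν / Real.pi) ^ ((d : ℝ) / 4) * (Real.pi / ν) ^ ((d : ℝ) / 2)) *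
          (Real.exp (‖l‖ ^ 2 / (4 * ν)) * Real.exp (-‖l‖ ^ 2 / (4 * ν))) := by ring
      _ = 1 := by rw [e3, e4, e1, one_mul]
  have h3 := congrArg (fun t : ℝ => (t : ℂ)) h2
  simp only [Complex.ofReal_mul, Complex.ofReal_one] at h3 ⊢
  linear_combination (-(∫ y, (MvPolynomial.eval (incl y).ofLp q *
    (Real.exp (-ν * ‖y‖ ^ 2) : ℂ)) * Complex.exp (Complex.I * (inner ℝ l y : ℝ)))) * h3

/-! ### Gaussian Laplace transforms and constant coefficient operators. -/

/-- The Laplace transform at `ν x` of `q` with respect to the weight `w(y) exp(-ν‖y‖²/2)`. -/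
noncomputable def gaussianLaplace (ν : ℝ) (w : RSp d → ℂ) (q : MvPolynomial (Fin d) ℂ)
    (x : RSp d) : ℂ :=
  ∫ y, MvPolynomial.eval (incl y).ofLp q * (w y * (Real.exp (-(ν / 2) * ‖y‖ ^ 2) : ℂ)) *
    Complex.exp (-ν * (inner ℝ y x : ℝ))

theorem continuous_gaussianLaplace_integrand {w : RSp d → ℂ} (hw : Continuous w)
    (q : MvPolynomial (Fin d) ℂ) (x : RSp d) : Continuous fun y : RSp d =>
      MvPolynomial.eval (incl y).ofLp q * (w y * (Real.exp (-(ν / 2) * ‖y‖ ^ 2) : ℂ)) *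
        Complex.exp (-ν * (inner ℝ y x : ℝ)) :=
  ((continuous_eval_incl q).mul (hw.mul (by fun_prop))).mul (by fun_prop)

/-- Half of the Gaussian absorbs the exponential: `‖y‖ M ≤ ‖y‖²/4 + M²`. The bound is uniform over
`‖x‖ ≤ M`, so it can dominate derivatives in `x`. -/
theorem norm_gaussianLaplace_integrand_le (hν : 0 < ν) {w : RSp d → ℂ} {B : ℝ}
    (hB : ∀ y, ‖w y‖ ≤ B) (q : MvPolynomial (Fin d) ℂ) {x : RSp d} {M : ℝ} (hx : ‖x‖ ≤ M)
    (y : RSp d) :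
    ‖MvPolynomial.eval (incl y).ofLp q * (w y * (Real.exp (-(ν / 2) * ‖y‖ ^ 2) : ℂ)) *
      Complex.exp (-ν * (inner ℝ y x : ℝ))‖ ≤ B * Real.exp (ν * M ^ 2) *
        ‖MvPolynomial.eval (incl y).ofLp q * (Real.exp (-(ν / 4) * ‖y‖ ^ 2) : ℂ)‖ := by
  have hB0 : 0 ≤ B := (norm_nonneg _).trans (hB 0)
  have h1 : ‖Complex.exp (-ν * (inner ℝ y x : ℝ))‖ = Real.exp (-ν * inner ℝ y x) := by
    rw [Complex.norm_exp]; simp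
  have h2 : -(ν / 2) * ‖y‖ ^ 2 + -ν * inner ℝ y x ≤ ν * M ^ 2 + -(ν / 4) * ‖y‖ ^ 2 := by
    have h3 : -(inner ℝ y x) ≤ ‖y‖ * M := (neg_le_abs _).trans
      ((abs_real_inner_le_norm y x).trans (by gcongr))
    nlinarith [sq_nonneg (‖y‖ / 2 - M)]
  simp only [norm_mul, h1, Complex.norm_real, Real.norm_of_nonneg (Real.exp_nonneg _)]
  calc _ = ‖w y‖ * ‖MvPolynomial.eval (incl y).ofLp q‖ *
        Real.exp (-(ν / 2) * ‖y‖ ^ 2 + -ν * inner ℝ y x) := by rw [Real.exp_add]; ring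
    _ ≤ B * ‖MvPolynomial.eval (incl y).ofLp q‖ *
        Real.exp (ν * M ^ 2 + -(ν / 4) * ‖y‖ ^ 2) := by
        gcongr
        exact hB y
    _ = _ := by rw [Real.exp_add]; ring

theorem integrable_gaussianLaplace (hν : 0 < ν) {w : RSp d → ℂ} (hw : Continuous w) {B : ℝ}
    (hB : ∀ y, ‖w y‖ ≤ B) (q : MvPolynomial (Fin d) ℂ) (x : RSp d) : Integrable fun y =>
      MvPolynomial.eval (incl y).ofLp q * (w y * (Real.exp (-(ν / 2) * ‖y‖ ^ 2) : ℂ)) *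
        Complex.exp (-ν * (inner ℝ y x : ℝ)) :=
  ((integrable_eval_mul_gaussian (b := ν / 4) (by positivity) q).norm.const_mul
    (B * Real.exp (ν * ‖x‖ ^ 2))).mono'
      (continuous_gaussianLaplace_integrand hw q x).aestronglyMeasurable
      (Filter.Eventually.of_forall (norm_gaussianLaplace_integrand_le hν hB q le_rfl))

/-- Differentiation under the integral brings down `-ν y_j`. Keeping the polynomial `q` as a
parameter makes the family stable under this, so it can be iterated. -/
theorem partialDeriv_gaussianLaplace (hν : 0 < ν) {w : RSp d → ℂ} (hw : Continuous w) {B : ℝ}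
    (hB : ∀ y, ‖w y‖ ≤ B) (q : MvPolynomial (Fin d) ℂ) (j : Fin d) :
    partialDeriv j (gaussianLaplace ν w q) =
      gaussianLaplace ν w (MvPolynomial.C (-ν : ℂ) * MvPolynomial.X j * q) := by
  funext x
  set v : RSp d := EuclideanSpace.single j 1 with hv
  have hvn : ‖v‖ = 1 := by simp [hv]
  set Q := MvPolynomial.C (-ν : ℂ) * MvPolynomial.X j * q with hQ
  have key := hasDerivAt_integral_of_dominated_loc_of_deriv_le (μ := (volume : Measure (RSp d)))
    (F := fun (t : ℝ) y => MvPolynomial.eval (incl y).ofLp q *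
      (w y * (Real.exp (-(ν / 2) * ‖y‖ ^ 2) : ℂ)) *
        Complex.exp (-ν * (inner ℝ y (x + t • v) : ℝ)))
    (F' := fun (t : ℝ) y => MvPolynomial.eval (incl y).ofLp Q *
      (w y * (Real.exp (-(ν / 2) * ‖y‖ ^ 2) : ℂ)) *
        Complex.exp (-ν * (inner ℝ y (x + t • v) : ℝ)))
    (x₀ := 0) (s := Metric.ball 0 1)
    -- For `|t| < 1` the point `x + t v` has norm at most `‖x‖ + 1`.
    (bound := fun y => B * Real.exp (ν * (‖x‖ + 1) ^ 2) *
        ‖MvPolynomial.eval (incl y).ofLp Q * (Real.exp (-(ν / 4) * ‖y‖ ^ 2) : ℂ)‖)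
    (Metric.ball_mem_nhds _ one_pos)
    (Filter.Eventually.of_forall fun t =>
      (continuous_gaussianLaplace_integrand hw q _).aestronglyMeasurable)
    (integrable_gaussianLaplace hν hw hB q _)
    (continuous_gaussianLaplace_integrand hw Q _).aestronglyMeasurable
    (Filter.Eventually.of_forall fun y t ht => norm_gaussianLaplace_integrand_le hν hB Q (by
      refine (norm_add_le _ _).trans ?_
      rw [norm_smul, hvn, mul_one]
      have := (mem_ball_zero_iff.1 ht).le
      gcongr) y)
    ((integrable_eval_mul_gaussian (b := ν / 4) (by positivity) Q).norm.const_mul _)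
    (Filter.Eventually.of_forall fun y t _ => by
      have h0 : HasDerivAt (fun t : ℝ => ((inner ℝ y (x + t • v) : ℝ) : ℂ)) (y j : ℂ) t := by
        refine HasDerivAt.ofReal_comp ?_
        have h1 : ∀ t : ℝ, inner ℝ y (x + t • v) = inner ℝ y x + t * y j := by
          intro t
          rw [inner_add_right, inner_smul_right, hv, EuclideanSpace.inner_single_right]
          simp
        simp only [h1]
        simpa using ((hasDerivAt_id t).mul_const (y j)).const_add (inner ℝ y x)
      refine ((h0.const_mul (-ν : ℂ)).cexp.const_mul _).congr_deriv ?_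
      rw [hQ]
      simp only [map_mul, MvPolynomial.eval_C, MvPolynomial.eval_X]
      have : (incl y).ofLp j = (y j : ℂ) := rfl
      rw [this]
      ring)
  have h2 := key.2.deriv
  simp only [zero_smul, add_zero] at h2
  exact h2

theorem multiDeriv_gaussianLaplace (hν : 0 < ν) {w : RSp d → ℂ} (hw : Continuous w) {B : ℝ}
    (hB : ∀ y, ‖w y‖ ≤ B) (q : MvPolynomial (Fin d) ℂ) (s : Fin d →₀ ℕ) :
    multiDeriv s (gaussianLaplace ν w q) =
      gaussianLaplace ν w (MvPolynomial.monomial s ((-ν : ℂ) ^ s.degree) * q) := by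
  have h1 : ∀ (j : Fin d) (n : ℕ) (q : MvPolynomial (Fin d) ℂ),
      (partialDeriv j)^[n] (gaussianLaplace ν w q) =
        gaussianLaplace ν w ((MvPolynomial.C (-ν : ℂ) * MvPolynomial.X j) ^ n * q) := by
    intro j n q
    induction n with
    | zero => simp
    | succ n ih =>
      rw [Function.iterate_succ_apply', ih, partialDeriv_gaussianLaplace hν hw hB, pow_succ',
        mul_assoc (MvPolynomial.C (-ν : ℂ) * MvPolynomial.X j)]
  have h2 : ∀ l : List (Fin d), l.foldr (fun j g => (partialDeriv j)^[s j] g)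
      (gaussianLaplace ν w q) = gaussianLaplace ν w
        ((l.map fun j => (MvPolynomial.C (-ν : ℂ) * MvPolynomial.X j) ^ s j).prod * q) := by
    intro l
    induction l with
    | nil => simp
    | cons j l ih => rw [List.foldr_cons, ih, h1, List.map_cons, List.prod_cons, mul_assoc]
  rw [multiDeriv, h2, ← Fin.prod_univ_def]
  congr 2
  rw [MvPolynomial.monomial_eq, Finsupp.prod_fintype _ _ (fun _ => pow_zero _),
    Finsupp.degree_eq_sum, ← Finset.prod_pow_eq_pow_sum, map_prod, ← Finset.prod_mul_distrib]
  exact Finset.prod_congr rfl fun j _ => by rw [mul_pow, MvPolynomial.C_pow]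

/-- A constant coefficient homogeneous differential operator on a Gaussian Laplace transform. -/
theorem polyDeriv_gaussianLaplace (hν : 0 < ν) {w : RSp d → ℂ} (hw : Continuous w) {B : ℝ}
    (hB : ∀ y, ‖w y‖ ≤ B) {N : ℕ} {p : MvPolynomial (Fin d) ℂ} (hp : p.IsHomogeneous N) :
    polyDeriv p (gaussianLaplace ν w 1) 0 = (-ν : ℂ) ^ N *
      ∫ y, MvPolynomial.eval (incl y).ofLp p * (w y * (Real.exp (-(ν / 2) * ‖y‖ ^ 2) : ℂ)) := by
  have h1 : ∀ q, Integrable fun y : RSp d => MvPolynomial.eval (incl y).ofLp q *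
      (w y * (Real.exp (-(ν / 2) * ‖y‖ ^ 2) : ℂ)) := by
    intro q
    simpa only [inner_zero_right, Complex.ofReal_zero, mul_zero, Complex.exp_zero, mul_one] using
      integrable_gaussianLaplace hν hw hB q 0
  unfold polyDeriv
  simp only [multiDeriv_gaussianLaplace hν hw hB, gaussianLaplace, inner_zero_right,
    Complex.ofReal_zero, mul_zero, Complex.exp_zero, mul_one, ← integral_const_mul]
  rw [← integral_finsetSum _ fun s _ => (h1 _).const_mul _]
  refine integral_congr_ae (Filter.Eventually.of_forall fun y => ?_)
  simp only
  conv_rhs => rw [MvPolynomial.eval_eq, Finset.sum_mul, Finset.mul_sum]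
  refine Finset.sum_congr rfl fun s hs => ?_
  -- Homogeneity: every monomial of `p` contributes the same power `(-ν)^N`, which therefore factors
  -- out of the sum.
  have hd : s.degree = N := by
    rw [Finsupp.degree_eq_weight_one]
    exact hp (MvPolynomial.mem_support_iff.1 hs)
  rw [MvPolynomial.eval_monomial, hd]
  simp only [Finsupp.prod]
  ring

/-! ### Averages of plane waves over `L`. -/

theorem inner_actR (k : Matrix.orthogonalGroup (Fin d) ℝ) (x y : RSp d) :
    inner ℝ (actR k x) (actR k y) = inner ℝ x y := by
  have hk : (k : Matrix (Fin d) (Fin d) ℝ).transpose * k = 1 :=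
    (Matrix.mem_orthogonalGroup_iff' _ _).1 k.2
  simp only [EuclideanSpace.inner_eq_star_dotProduct, star_trivial, actR]
  rw [Matrix.dotProduct_mulVec, ← Matrix.mulVec_transpose, Matrix.mulVec_mulVec, hk,
    Matrix.one_mulVec]

/-- A real orthogonal matrix as a linear isometry. -/
noncomputable def actIso (k : Matrix.orthogonalGroup (Fin d) ℝ) : RSp d ≃ₗᵢ[ℝ] RSp d :=
  LinearIsometry.toLinearIsometryEquiv
    (LinearMap.isometryOfInner (E := RSp d) (E' := RSp d)
      { toFun := actR k
        map_add' := fun x y => by simp [actR, Matrix.mulVec_add]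
        map_smul' := fun c x => by simp [actR, Matrix.mulVec_smul] } (inner_actR k)) rfl

theorem actC_incl (k : Matrix.orthogonalGroup (Fin d) ℝ) (x : RSp d) :
    actC k (incl x) = incl (actR k x) := by
  ext j
  simp [actC, actR, incl, Matrix.mulVec, dotProduct]

theorem integral_comp_actR (k : Matrix.orthogonalGroup (Fin d) ℝ) (f : RSp d → ℂ) :
    ∫ y, f (actR k y) = ∫ y, f y :=
  (actIso k).measurePreserving.integral_comp (actIso k).toHomeomorph.measurableEmbedding f

namespace RealJordanForm
variable (T : RealJordanForm d)

theorem continuous_act : Continuous fun q : T.L × RSp d => T.act q.1 q.2 := by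
  unfold act actR
  refine (PiLp.continuous_toLp 2 _).comp (Continuous.matrix_mulVec ?_ ?_)
  · exact continuous_subtype_val.comp
      (continuous_subtype_val.comp (continuous_subtype_val.comp continuous_fst))
  · exact (PiLp.continuous_ofLp 2 _).comp continuous_snd

theorem norm_act (l : T.L) (x : RSp d) : ‖T.act l x‖ = ‖x‖ := (actIso l.1.1).norm_map x

/-- The average of the plane wave `exp(i⟨v, x⟩)` over `L`. -/
noncomputable def planeAverage (v x : RSp d) : ℂ :=
  ∫ l, Complex.exp (Complex.I * (inner ℝ v (T.act l x) : ℝ)) ∂T.haarL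

theorem norm_planeAverage_le (v x : RSp d) : ‖T.planeAverage v x‖ ≤ 1 := by
  refine (norm_integral_le_of_norm_le_const (C := 1)
    (Filter.Eventually.of_forall fun l => (norm_exp_I_mul_ofReal _).le)).trans ?_
  simp

theorem continuous_planeWave (v : RSp d) : Continuous fun q : T.L × RSp d =>
    Complex.exp (Complex.I * (inner ℝ v (T.act q.1 q.2) : ℝ)) := by
  have := T.continuous_act
  fun_prop

theorem continuous_planeAverage (v : RSp d) : Continuous (T.planeAverage v) := by
  have h1 : ∀ x, Continuous fun l : T.L =>
      Complex.exp (Complex.I * (inner ℝ v (T.act l x) : ℝ)) := fun x =>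
    (T.continuous_planeWave v).comp (f := fun l : T.L => (l, x)) (by fun_prop)
  have h2 : ∀ l : T.L, Continuous fun x =>
      Complex.exp (Complex.I * (inner ℝ v (T.act l x) : ℝ)) := fun l =>
    (T.continuous_planeWave v).comp (f := fun x => (l, x)) (by fun_prop)
  have h3 : Integrable (fun _ : T.L => (1 : ℝ)) T.haarL := integrable_const _
  exact continuous_of_dominated (fun x => (h1 x).aestronglyMeasurable)
    (fun x => Filter.Eventually.of_forall fun l => (norm_exp_I_mul_ofReal _).le) h3
    (Filter.Eventually.of_forall h2)

/-- Fubini on `V × L`: `L` has mass one and plane waves have modulus one, so integrability of `F`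
suffices. -/
theorem integral_mul_planeAverage (v : RSp d) {F : RSp d → ℂ} (hF : Integrable F) :
    ∫ y, F y * T.planeAverage v y =
      ∫ l, (∫ y, F y * Complex.exp (Complex.I * (inner ℝ v (T.act l y) : ℝ))) ∂T.haarL := by
  simp only [planeAverage, ← integral_const_mul]
  refine integral_integral_swap ?_
  have h1 : Integrable (fun q : RSp d × T.L => F q.1) (volume.prod T.haarL) := hF.comp_fst _
  exact h1.mul_bdd (c := 1)
    (((T.continuous_planeWave v).comp continuous_swap).aestronglyMeasurable)
    (Filter.Eventually.of_forall fun q => (norm_exp_I_mul_ofReal _).le)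

/-- For each `l`, the substitution `y ↦ l y` preserves Lebesgue measure and `F`, so the inner
integral does not depend on `l`. -/
theorem integral_mul_planeAverage_of_invariant (v : RSp d) {F : RSp d → ℂ} (hF : Integrable F)
    (hinv : ∀ (l : T.L) y, F (T.act l y) = F y) :
    ∫ y, F y * T.planeAverage v y = ∫ y, F y * Complex.exp (Complex.I * (inner ℝ v y : ℝ)) := by
  rw [T.integral_mul_planeAverage v hF]
  have : ∀ l : T.L, ∫ y, F y * Complex.exp (Complex.I * (inner ℝ v (T.act l y) : ℝ)) =
      ∫ y, F y * Complex.exp (Complex.I * (inner ℝ v y : ℝ)) := by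
    intro l
    refine Eq.trans ?_ (integral_comp_actR l.1.1 _)
    refine integral_congr_ae (Filter.Eventually.of_forall fun y => ?_)
    simp only
    rw [← hinv l y]
    rfl
  simp [this]

end RealJordanForm

/-! ### The Rodrigues type formula and the comparison of constants. -/

/-- With `y = u - x` the real exponent becomes `-ν‖u‖²/2 + ν‖x‖²/2`. This produces the factor
`exp(ν‖x‖²/2)` of the Rodrigues type formula, and the shift of the plane wave produces `exp(-i⟨v,
x⟩)`. -/
theorem integral_gaussian_fourier_laplace (hν : 0 < ν) (v x : RSp d) :
    ∫ y : RSp d, (Real.exp (-(ν / 2) * ‖y‖ ^ 2) : ℂ) * Complex.exp (-ν * (inner ℝ y x : ℝ)) *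
      Complex.exp (Complex.I * (inner ℝ v y : ℝ)) =
      (((2 * Real.pi / ν) ^ ((d : ℝ) / 2) * Real.exp (-‖v‖ ^ 2 / (2 * ν)) : ℝ) : ℂ) *
        ((Real.exp (ν / 2 * ‖x‖ ^ 2) : ℂ) * Complex.exp (-Complex.I * (inner ℝ v x : ℝ))) := by
  have h := integral_gaussian_fourier (half_pos hν) v
  rw [show Real.pi / (ν / 2) = 2 * Real.pi / ν by field_simp, show 4 * (ν / 2) = 2 * ν by ring] at h
  rw [← h, ← integral_mul_const]
  conv_lhs => rw [← integral_sub_right_eq_self _ x]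
  refine integral_congr_ae (Filter.Eventually.of_forall fun u => ?_)
  simp only [Complex.ofReal_exp, ← Complex.exp_add]
  congr 1
  have h1 : ‖u - x‖ ^ 2 = ‖u‖ ^ 2 - 2 * inner ℝ u x + ‖x‖ ^ 2 := norm_sub_sq_real u x
  have h2 : inner ℝ (u - x) x = inner ℝ u x - ‖x‖ ^ 2 := by
    rw [inner_sub_left, real_inner_self_eq_norm_sq]
  have h3 : inner ℝ v (u - x) = inner ℝ v u - inner ℝ v x := inner_sub_right _ _ _
  rw [h1, h2, h3]
  push_cast
  ring

namespace RealJordanForm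
variable (T : RealJordanForm d)

/-- The Bessel function as a Gaussian Laplace transform. -/
theorem gaussianLaplace_planeAverage (hν : 0 < ν) (v x : RSp d) :
    gaussianLaplace ν (T.planeAverage v) 1 x =
      (((2 * Real.pi / ν) ^ ((d : ℝ) / 2) * Real.exp (-‖v‖ ^ 2 / (2 * ν)) : ℝ) : ℂ) *
        ((Real.exp (ν / 2 * ‖x‖ ^ 2) : ℂ) *
          ∫ l, Complex.exp (-Complex.I * (inner ℝ v (T.act l x) : ℝ)) ∂T.haarL) := by
  have hF : Integrable fun y : RSp d => (Real.exp (-(ν / 2) * ‖y‖ ^ 2) : ℂ) *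
      Complex.exp (-ν * (inner ℝ y x : ℝ)) := by
    simpa using integrable_gaussianLaplace hν (w := fun _ => 1) continuous_const (B := 1)
      (fun _ => by simp) (1 : MvPolynomial (Fin d) ℂ) x
  have h1 : ∀ l : T.L, ∫ y, (Real.exp (-(ν / 2) * ‖y‖ ^ 2) : ℂ) *
      Complex.exp (-ν * (inner ℝ y x : ℝ)) *
        Complex.exp (Complex.I * (inner ℝ v (T.act l y) : ℝ)) =
      (((2 * Real.pi / ν) ^ ((d : ℝ) / 2) * Real.exp (-‖v‖ ^ 2 / (2 * ν)) : ℝ) : ℂ) *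
        ((Real.exp (ν / 2 * ‖x‖ ^ 2) : ℂ) *
          Complex.exp (-Complex.I * (inner ℝ v (T.act l x) : ℝ))) := by
    intro l
    -- The formula is used at the point `l x`, followed by the substitution `y ↦ l y`; orthogonality
    -- of `l` restores `‖y‖` and `⟨y, x⟩`.
    rw [← T.norm_act l x, ← integral_gaussian_fourier_laplace hν]
    conv_rhs => rw [← integral_comp_actR l.1.1]
    refine integral_congr_ae (Filter.Eventually.of_forall fun y => ?_)
    simp only
    have h2 : ‖actR l.1.1 y‖ = ‖y‖ := T.norm_act l y
    have h3 : inner ℝ (actR l.1.1 y) (T.act l x) = inner ℝ y x := inner_actR l.1.1 y x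
    rw [h2, h3]
    rfl
  rw [← integral_const_mul, ← integral_const_mul]
  simp only [← h1]
  rw [← T.integral_mul_planeAverage v hF]
  refine integral_congr_ae (Filter.Eventually.of_forall fun y => ?_)
  simp only [map_one]
  ring

variable {r : ℕ} {e : Fin r → RSp d}

/-- The vector representing a functional on `𝔞`. -/
theorem exists_extendFunctional_eq_inner (lam : StrongDual ℝ (cartan e)) :
    ∃ v : RSp d, ‖v‖ = ‖lam‖ ∧ ∀ x, extendFunctional lam x = inner ℝ v x := by
  -- The Riesz vector of `λ` lies in `𝔞`, so pairing it with `x` or with the projection of `x` is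
  -- the same.
  refine ⟨((InnerProductSpace.toDual ℝ (cartan e)).symm lam : cartan e), ?_, fun x => ?_⟩
  · exact (InnerProductSpace.toDual ℝ (cartan e)).symm.norm_map lam
  · rw [extendFunctional, ← InnerProductSpace.toDual_symm_apply (𝕜 := ℝ),
      Submodule.inner_orthogonalProjectionOnto_eq_of_mem_left]

end RealJordanForm

/-- The Rodrigues type formula as a Fourier integral, for invariant homogeneous polynomials. -/
theorem polyDeriv_exp_mul_bessel (T : RealJordanForm d) (hν : 0 < ν) {N : ℕ}
    {p : MvPolynomial (Fin d) ℂ} (hp : p.IsHomogeneous N)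
    (hinv : ∀ (l : T.L) (z : CSp d),
      MvPolynomial.eval (actC l.1.1 z).ofLp p = MvPolynomial.eval z.ofLp p) (v : RSp d) :
    (((2 * Real.pi / ν) ^ ((d : ℝ) / 2) * Real.exp (-‖v‖ ^ 2 / (2 * ν)) : ℝ) : ℂ) *
      polyDeriv p (fun x => (Real.exp (ν / 2 * ‖x‖ ^ 2) : ℂ) *
        ∫ l, Complex.exp (-Complex.I * (inner ℝ v (T.act l x) : ℝ)) ∂T.haarL) 0 =
      (-ν : ℂ) ^ N * ∫ x, (MvPolynomial.eval (incl x).ofLp p *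
        (Real.exp (-(ν / 2) * ‖x‖ ^ 2) : ℂ)) * Complex.exp (Complex.I * (inner ℝ v x : ℝ)) := by
  set c : ℂ := (((2 * Real.pi / ν) ^ ((d : ℝ) / 2) * Real.exp (-‖v‖ ^ 2 / (2 * ν)) : ℝ) : ℂ) with hc
  have hc0 : c ≠ 0 := Complex.ofReal_ne_zero.2 (by positivity)
  -- The constant is moved into the weight, so that `p(∂_x)` acts on an actual Gaussian Laplace
  -- transform.
  have h1 : (fun x => (Real.exp (ν / 2 * ‖x‖ ^ 2) : ℂ) *
      ∫ l, Complex.exp (-Complex.I * (inner ℝ v (T.act l x) : ℝ)) ∂T.haarL) =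
      gaussianLaplace ν (fun y => c⁻¹ * T.planeAverage v y) 1 := by
    funext x
    have h2 := T.gaussianLaplace_planeAverage hν v x
    rw [← hc] at h2
    rw [← inv_mul_cancel_left₀ hc0 ((Real.exp (ν / 2 * ‖x‖ ^ 2) : ℂ) * _), ← h2, gaussianLaplace,
      gaussianLaplace, ← integral_const_mul]
    refine integral_congr_ae (Filter.Eventually.of_forall fun y => ?_)
    simp only
    ring
  have hB : ∀ y, ‖c⁻¹ * T.planeAverage v y‖ ≤ ‖c⁻¹‖ := by
    intro y
    rw [norm_mul]
    exact mul_le_of_le_one_right (norm_nonneg _) (T.norm_planeAverage_le v y)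
  have hwc : Continuous fun y => c⁻¹ * T.planeAverage v y :=
    continuous_const.mul (T.continuous_planeAverage v)
  rw [h1, polyDeriv_gaussianLaplace hν hwc hB hp,
    mul_left_comm, ← T.integral_mul_planeAverage_of_invariant v
      (integrable_eval_mul_gaussian (half_pos hν) p), ← integral_const_mul c]
  · congr 1
    refine integral_congr_ae (Filter.Eventually.of_forall fun y => ?_)
    simp only
    field_simp
  · intro l y
    -- On real points the complexified action is the action on `V`, so `p(y) exp(-ν‖y‖²/2)` is
    -- `L`-invariant.
    rw [T.norm_act, ← hinv l (incl y), actC_incl]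
    rfl

/-- The Fourier transform of the Segal-Bargmann transform of an invariant homogeneous polynomial. -/
theorem fourierOnCartan_segalBargmann (T : RealJordanForm d) {r : ℕ} {e : Fin r → RSp d}
    (hν : 0 < ν) {N : ℕ} {p : MvPolynomial (Fin d) ℂ} (hp : p.IsHomogeneous N) (hp0 : p ≠ 0)
    (hinv : ∀ (l : T.L) (z : CSp d),
      MvPolynomial.eval (actC l.1.1 z).ofLp p = MvPolynomial.eval z.ofLp p)
    (lam : StrongDual ℝ (RealJordanForm.cartan e)) :
    fourierOnCartan (segalBargmann hν (fockPoly hν p)) lam =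
      ((-ν : ℂ) ^ N)⁻¹ * (((2 * Real.pi / ν) ^ ((d : ℝ) / 4) : ℝ) : ℂ) *
        ((‖fockPoly one_pos p‖ ^ 2 : ℝ) : ℂ) * hermite T p ν lam *
          (Real.exp (-‖lam‖ ^ 2 / (4 * ν)) : ℂ) := by
  obtain ⟨v, hv, hlam⟩ := RealJordanForm.exists_extendFunctional_eq_inner lam
  have hnorm : ((‖fockPoly one_pos p‖ ^ 2 : ℝ) : ℂ) ≠ 0 := by
    -- If the Fock norm of `p` were zero, the reproducing property would make `p` vanish at every
    -- point.
    refine Complex.ofReal_ne_zero.2 (pow_ne_zero _ (norm_ne_zero_iff.2 fun h => hp0 ?_))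
    refine MvPolynomial.funext fun x => ?_
    have h1 := congrFun (fockRep_fockPoly one_pos p) (WithLp.toLp 2 x)
    rw [h, ← inner_fockKernel one_pos, inner_zero_right] at h1
    rw [map_zero]
    exact h1.symm
  have h2 := polyDeriv_exp_mul_bessel T hν hp hinv v
  have h3 : ∀ x, T.bessel lam x =
      ∫ l, Complex.exp (-Complex.I * (inner ℝ v (T.act l x) : ℝ)) ∂T.haarL := by
    intro x
    simp only [RealJordanForm.bessel, hlam]
  have hν0 : (-ν : ℂ) ^ N ≠ 0 := pow_ne_zero _ (by simpa using hν.ne')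
  have h4 : fourierOnCartan (segalBargmann hν (fockPoly hν p)) lam =
      ∫ x, segalBargmann hν (fockPoly hν p) x * Complex.exp (Complex.I * (inner ℝ v x : ℝ)) := by
    simp only [fourierOnCartan, hlam]
  -- The constants of the two computations multiply: `-d/4 + d/2 = d/4` and `1/(4ν) - 1/(2ν) =
  -- -1/(4ν)`.
  have h5 : (2 * Real.pi / ν) ^ (-(d : ℝ) / 4) * Real.exp (‖v‖ ^ 2 / (4 * ν)) *
      ((2 * Real.pi / ν) ^ ((d : ℝ) / 2) * Real.exp (-‖v‖ ^ 2 / (2 * ν))) =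
      (2 * Real.pi / ν) ^ ((d : ℝ) / 4) * Real.exp (-‖v‖ ^ 2 / (4 * ν)) := by
    rw [mul_mul_mul_comm, ← Real.rpow_add (by positivity), ← Real.exp_add]
    congr 2
    · ring
    · field_simp; ring
  have h6 := congrArg (fun t : ℝ => (t : ℂ)) h5
  simp only [Complex.ofReal_mul] at h2 h6
  rw [h4, fourier_segalBargmann_fockPoly, eq_comm, hermite]
  simp only [h3]
  set P := polyDeriv p (fun x => (Real.exp (ν / 2 * ‖x‖ ^ 2) : ℂ) *
        ∫ l, Complex.exp (-Complex.I * (inner ℝ v (T.act l x) : ℝ)) ∂T.haarL) 0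
  set I₀ := ∫ x, (MvPolynomial.eval (incl x).ofLp p *
        (Real.exp (-(ν / 2) * ‖x‖ ^ 2) : ℂ)) * Complex.exp (Complex.I * (inner ℝ v x : ℝ))
  have h7 : I₀ = ((-ν : ℂ) ^ N)⁻¹ * ((((2 * Real.pi / ν) ^ ((d : ℝ) / 2) : ℝ) : ℂ) *
      (Real.exp (-‖v‖ ^ 2 / (2 * ν)) : ℂ) * P) := by
    rw [h2, inv_mul_cancel_left₀ hν0]
  rw [h7, ← hv, Complex.ofReal_mul]
  have h8 : ((‖fockPoly one_pos p‖ ^ 2 : ℝ) : ℂ) *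
      (1 / ((‖fockPoly one_pos p‖ ^ 2 : ℝ) : ℂ) * P) = P := by
    rw [one_div, mul_inv_cancel_left₀ hnorm]
  linear_combination (((-ν : ℂ) ^ N)⁻¹ * (((2 * Real.pi / ν) ^ ((d : ℝ) / 4) : ℝ) : ℂ) *
    (Real.exp (-‖v‖ ^ 2 / (4 * ν)) : ℂ)) * h8 - (((-ν : ℂ) ^ N)⁻¹ * P) * h6

/-- Treats both types together. The value at `(1, …, 1)` comes from the normalisation of `Ω` and
serves to show `p ≠ 0`. -/
theorem RealJordanForm.IsSphericalPolynomial.exists_isInvariantExtension {T : RealJordanForm d}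
    {r : ℕ} {e : Fin r → RSp d} {a : ℕ} {n : List ℕ} {p : MvPolynomial (Fin d) ℂ}
    (h : T.IsSphericalPolynomial e a n p) :
    ∃ q : (Fin r → ℝ) → ℝ, q (fun _ => 1) = 1 ∧ T.IsInvariantExtension e n.sum q p := by
  rcases h with ⟨-, m, Ω, -, hΩ, -, hp⟩ | ⟨-, m, m₀, Ω, -, hΩ, -, hp⟩
  · exact ⟨_, by simpa using hΩ.normalized, hp⟩
  · exact ⟨_, by simpa using hΩ.normalized, hp⟩

end SegalBargmann

theorem proposition8p3 {d r : ℕ} (T : SegalBargmann.RealJordanForm d)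
    (e : Fin r → SegalBargmann.RSp d) (he : T.IsFrame e)
    (a : ℕ) (ha : ∀ j k, j ≠ k → T.rootMultiplicity e (Pi.single j 1 - Pi.single k 1) = a)
    (n : List ℕ) (p : MvPolynomial (Fin d) ℂ) (hp : T.IsSphericalPolynomial e a n p)
    (ν : ℝ) (hν : 0 < ν)
    (lam : StrongDual ℝ (SegalBargmann.RealJordanForm.cartan e)) :
    MeasureTheory.Integrable
        (SegalBargmann.segalBargmann hν (SegalBargmann.fockPoly hν p)) MeasureTheory.volume ∧
      SegalBargmann.fourierOnCartan
          (SegalBargmann.segalBargmann hν (SegalBargmann.fockPoly hν p)) lam =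
        ((-ν : ℂ) ^ n.sum)⁻¹ * (((2 * Real.pi / ν) ^ ((d : ℝ) / 4) : ℝ) : ℂ) *
          ((‖SegalBargmann.fockPoly one_pos p‖ ^ 2 : ℝ) : ℂ) *
          SegalBargmann.hermite T p ν lam *
          (Real.exp (-‖lam‖ ^ 2 / (4 * ν)) : ℂ) := by
  obtain ⟨q, hq, h⟩ := hp.exists_isInvariantExtension
  have hp0 : p ≠ 0 := by
    rintro rfl
    have := h.restrict fun _ => 1
    rw [hq, map_zero] at this
    norm_num at this
  exact ⟨SegalBargmann.integrable_segalBargmann_fockPoly hν p,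
    SegalBargmann.fourierOnCartan_segalBargmann T hν h.isHomogeneous hp0 h.invariant lam⟩
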